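/- Let $k$ be a field and $n\ge 0$ an integer. A functor means a functor from $k$-modules to $k$-modules (not necessarily additive), and $T_n$ denotes the functor $V\mapsto V^{\otimes n}$. Let $\bar V_n$ be the $k$-module with basis $x_1,\dots,x_n$, and for $1\le i\le n$ let $d_i\colon\bar V_n\to\bar V_{n-1}$ be the linear map with $d_i(x_j)=x_j$ for $j<i$, $d_i(x_i)=0$ and $d_i(x_j)=x_{j-1}$ for $j>i$. For a functor $B$ put $$\gamma_n(B)=\bigcap_{i=1}^n\ker\bigl(B(d_i)\colon B(\bar V_n)\to B(\bar V_{n-1})\bigr)$$ (so $\gamma_0(B)=B(0)$). Products in the symmetric group $\Sigma_n$ are composed from left to right, $(\sigma\tau)(i)=\tau(\sigma(i))$. Then $\gamma_n(B)$ is a right $k\Sigma_n$-module, where $\sigma$ acts by $B(x_j\mapsto x_{\sigma(j)})$, and $V^{\otimes n}$ is a left $k\Sigma_n$-module by $\sigma\cdot(a_1\otimes\cdots\otimes a_n)=a_{\sigma(1)}\otimes\cdots\otimes a_{\sigma(n)}$. The dual functor $B^*$ is given by $B^*(V)=B(V^*)^*$ for finite-dimensional $V$, and by $B^*(V)=\operatorname{colim}_{S}B^*(S)$,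 over the finite-dimensional submodules $S$ of $V$, in general. A free $T_n$-functor is a direct sum of (arbitrarily many) copies of $T_n$. A functor $B$ is called $T_n$-projective if there are a free $T_n$-functor $F$ and natural transformations $s\colon B\to F$, $r\colon F\to B$ such that $r\circ s$ is a natural equivalence. Proposition 2.10. Let $B$ be a functor. 1) If $B$ is $T_n$-projective, then $\gamma_n(B)$ is a projective $k\Sigma_n$-module and there is an isomorphism $\gamma_n(B)\otimes_{k\Sigma_n}V^{\otimes n}\cong B(V)$, natural in the module $V$. 2) If $B$ is a subfunctor of a direct sum of finitely many copies of $T_n$ and $\gamma_n(B)$ is a projective $k\Sigma_n$-module, then $B$ is $T_n$-projective, and there is a natural equivalence $B\cong B^*$. 3) If $B$ is a quotient functor of a direct sum of finitely many copies of $T_n$ and $\gamma_n(B)$ is a projective $k\Sigma_n$-module, then $B$ is $T_n$-projective, and there is a natural equivalence $B\cong B^*$. 4) If $B$ is a sub-quotient functor of a direct sum of finitely many copies of $T_n$ and $B$ is $T_n$-projective, then $B$ is both projective and injective in the category of sub-quotient functors of direct sums of finitely many copies of $T_n$ (with all natural transformations as morphisms). -/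

import Mathlib

open CategoryTheory TensorProduct
open scoped DirectSum MonoidAlgebra

universe u

namespace TensorFunctor

noncomputable section

/-! Throughout, a functor from modules to modules is an arbitrary (not necessarily additive)
functor `ModuleCat k ⥤ ModuleCat k`, where `k` is a field. -/

section TensorPower

variable (k : Type u) [Field k] (n : ℕ)

/-- The functor `T_n : V ↦ V^{⊗ n}`. -/
def tensorPow : ModuleCat.{u} k ⥤ ModuleCat.{u} k where
  obj V := ModuleCat.of k (⨂[k] _ : Fin n, V)
  map f := ModuleCat.ofHom (PiTensorProduct.map fun _ => f.hom)
  map_id V := by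
    ext : 1
    exact PiTensorProduct.map_id
  map_comp f g := by
    ext : 1
    exact PiTensorProduct.map_comp (fun _ => g.hom) (fun _ => f.hom)

/-- The direct sum of copies of `T_n` indexed by `J`, that is `V ↦ ⨁_{j ∈ J} V^{⊗ n}`:
the free `T_n`-functor on `J`. -/
def freeTensorPow (J : Type u) : ModuleCat.{u} k ⥤ ModuleCat.{u} k where
  obj V := ModuleCat.of k (J →₀ (tensorPow k n).obj V)
  map f := ModuleCat.ofHom (Finsupp.mapRange.linearMap ((tensorPow k n).map f).hom)
  map_id V := by
    ext : 1
    simp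
  map_comp f g := by
    ext : 1
    simp [Finsupp.mapRange.linearMap_comp]

/-- The place permutation on `V^{⊗ n}`:
`a_1 ⊗ ⋯ ⊗ a_n ↦ a_{σ(1)} ⊗ ⋯ ⊗ a_{σ(n)}`. -/
def placePerm (V : ModuleCat.{u} k) (σ : Equiv.Perm (Fin n)) :
    (⨂[k] _ : Fin n, V) →ₗ[k] ⨂[k] _ : Fin n, V :=
  (PiTensorProduct.reindex k (fun _ : Fin n => (V : Type u)) σ.symm).toLinearMap

theorem placePerm_tprod (V : ModuleCat.{u} k) (σ : Equiv.Perm (Fin n)) (a : Fin n → V) :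
    placePerm k n V σ (PiTensorProduct.tprod k a)
      = PiTensorProduct.tprod k (fun i => a (σ i)) := by
  exact PiTensorProduct.reindex_tprod σ.symm a

theorem placePerm_map {V W : ModuleCat.{u} k} (f : V ⟶ W) (σ : Equiv.Perm (Fin n))
    (t : ⨂[k] _ : Fin n, V) :
    PiTensorProduct.map (fun _ => f.hom) (placePerm k n V σ t)
      = placePerm k n W σ (PiTensorProduct.map (fun _ => f.hom) t) :=
  PiTensorProduct.map_reindex (fun _ => f.hom) σ.symm t

/-- `V̄_n`, the `n`-dimensional module with basis `x_i = Pi.single i 1`. -/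
abbrev stdMod : ModuleCat.{u} k := ModuleCat.of k (Fin n → k)

variable {n}

/-- The linear endomorphism `x_j ↦ x_{σ(j)}` of `V̄_n`. -/
def permMap (σ : Equiv.Perm (Fin n)) : stdMod k n ⟶ stdMod k n :=
  ModuleCat.ofHom ((Pi.basisFun k (Fin n)).constr k fun j => Pi.single (σ j) 1)

/-- The map `d_i : V̄_n ⟶ V̄_{n-1}` with `x_j ↦ x_j` for `j < i`, `x_i ↦ 0` and
`x_j ↦ x_{j-1}` for `j > i`. -/
def face (i : Fin n) : stdMod k n ⟶ stdMod k (n - 1) :=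
  ModuleCat.ofHom ((Pi.basisFun k (Fin n)).constr k fun j =>
    if h : j < i then Pi.single (⟨j, by omega⟩ : Fin (n - 1)) 1
    else if h' : i < j then Pi.single (⟨j - 1, by omega⟩ : Fin (n - 1)) 1
    else 0)

/-- A section of `face k i`, only used to see that the Schur module is stable. -/
def coface (i : Fin n) : stdMod k (n - 1) ⟶ stdMod k n :=
  ModuleCat.ofHom ((Pi.basisFun k (Fin (n - 1))).constr k fun j =>
    if (j : ℕ) < i then Pi.single (⟨j, by omega⟩ : Fin n) 1
    else Pi.single (⟨j + 1, by omega⟩ : Fin n) 1)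

theorem permMap_single (σ : Equiv.Perm (Fin n)) (j : Fin n) :
    (permMap k σ).hom (Pi.single j 1) = Pi.single (σ j) 1 := by
  have := (Pi.basisFun k (Fin n)).constr_basis k
    (fun j => (Pi.single (σ j) 1 : Fin n → k)) j
  rwa [Pi.basisFun_apply] at this

theorem face_single (i j : Fin n) :
    (face k i).hom (Pi.single j 1) =
      if h : j < i then Pi.single (⟨j, by omega⟩ : Fin (n - 1)) 1
      else if h' : i < j then Pi.single (⟨j - 1, by omega⟩ : Fin (n - 1)) 1
      else 0 := by
  have := (Pi.basisFun k (Fin n)).constr_basis k (fun j =>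
    if h : j < i then (Pi.single (⟨j, by omega⟩ : Fin (n - 1)) 1 : Fin (n - 1) → k)
    else if h' : i < j then Pi.single (⟨j - 1, by omega⟩ : Fin (n - 1)) 1
    else 0) j
  rwa [Pi.basisFun_apply] at this

theorem coface_single (i : Fin n) (j : Fin (n - 1)) :
    (coface k i).hom (Pi.single j 1) =
      if (j : ℕ) < i then Pi.single (⟨j, by omega⟩ : Fin n) 1
      else Pi.single (⟨j + 1, by omega⟩ : Fin n) 1 := by
  have := (Pi.basisFun k (Fin (n - 1))).constr_basis k (fun j =>
    if (j : ℕ) < i then (Pi.single (⟨j, by omega⟩ : Fin n) 1 : Fin n → k)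
    else Pi.single (⟨j + 1, by omega⟩ : Fin n) 1) j
  rwa [Pi.basisFun_apply] at this

theorem stdMod_hom_ext {n : ℕ} {V : ModuleCat.{u} k} {f g : stdMod k n ⟶ V}
    (h : ∀ j, f.hom (Pi.single j 1) = g.hom (Pi.single j 1)) : f = g := by
  ext : 1
  refine (Pi.basisFun k (Fin n)).ext fun j => ?_
  rw [Pi.basisFun_apply]
  exact h j

theorem permMap_one : permMap k (1 : Equiv.Perm (Fin n)) = 𝟙 _ :=
  stdMod_hom_ext k fun j => by rw [permMap_single]; rfl

theorem permMap_mul (σ τ : Equiv.Perm (Fin n)) :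
    permMap k (σ * τ) = permMap k τ ≫ permMap k σ :=
  stdMod_hom_ext k fun j => by
    rw [ModuleCat.hom_comp, LinearMap.comp_apply, permMap_single, permMap_single, permMap_single]
    rfl

theorem permMap_face (σ : Equiv.Perm (Fin n)) (i : Fin n) :
    permMap k σ ≫ face k (σ i)
      = face k i ≫ coface k i ≫ permMap k σ ≫ face k (σ i) :=
  stdMod_hom_ext k fun j => by
    simp only [ModuleCat.hom_comp, LinearMap.comp_apply]
    rw [face_single k i j]
    split_ifs with h h'
    · rw [coface_single, if_pos (by simpa using h)]
    · have hj : ¬ ((⟨j - 1, by omega⟩ : Fin (n - 1)) : ℕ) < i := by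
        simp only; omega
      rw [coface_single, if_neg hj]
      have hj' : (⟨(j : ℕ) - 1 + 1, by omega⟩ : Fin n) = j := by
        ext; simp only; omega
      rw [hj']
    · have hij : j = i := by omega
      subst hij
      rw [permMap_single, face_single, dif_neg (lt_irrefl _), dif_neg (lt_irrefl _), map_zero,
        map_zero, map_zero]

end TensorPower

section Schur

variable {k : Type u} [Field k] (n : ℕ) (B : ModuleCat.{u} k ⥤ ModuleCat.{u} k)

/-- The action of the symmetric group on `B(V̄_n)`: `σ` acts by `B(x_j ↦ x_{σ(j)})`.

A product of permutations in `Equiv.Perm` is composed from right to left, and for this product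
the action is a left action. With the product composed from left to right it is the same thing
as a right action, given by the same formula. -/
def schurAmbient : Representation k (Equiv.Perm (Fin n)) (B.obj (stdMod k n)) where
  toFun σ := (B.map (permMap k σ)).hom
  map_one' := by rw [permMap_one, B.map_id]; rfl
  map_mul' σ τ := by rw [permMap_mul, B.map_comp]; rfl

/-- `γ_n(B) = ⋂_i ker (B(d_i) : B(V̄_n) → B(V̄_{n-1}))`, as a subspace with its action of the
symmetric group. -/
def schurSub : Subrepresentation (schurAmbient n B) where
  toSubmodule := ⨅ i : Fin n, LinearMap.ker (B.map (face k i)).hom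
  apply_mem_toSubmodule σ v hv := by
    rw [Submodule.mem_iInf] at hv ⊢
    intro i
    obtain ⟨i, rfl⟩ := σ.surjective i
    have h := congrArg (fun f => (B.map f).hom v) (permMap_face k σ i)
    simp only [B.map_comp, ModuleCat.hom_comp, LinearMap.comp_apply] at h
    have h0 : (B.map (face k i)).hom v = 0 := hv i
    rw [h0] at h
    simp only [map_zero] at h
    exact h

/-- The representation `γ_n(B)` of the symmetric group. -/
def schurRep : Representation k (Equiv.Perm (Fin n)) (schurSub n B).toSubmodule :=
  (schurSub n B).toRepresentation

/-- `γ_n(B)` as a module over the group algebra `k(Σ_n)`. -/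
abbrev SchurModule : Type u := (schurRep n B).asModule

/-- The relations `α·σ ⊗ t = α ⊗ σ·t`, which cut the tensor product over `k(Σ_n)` out of the one
over `k`. Here `α·σ` is the action on `γ_n(B)` and `σ·(a_1 ⋯ a_n) = a_{σ(1)} ⋯ a_{σ(n)}`. -/
def balancedRel (V : ModuleCat.{u} k) :
    Submodule k ((schurSub n B).toSubmodule ⊗[k] (⨂[k] _ : Fin n, V)) :=
  Submodule.span k {z | ∃ (σ : Equiv.Perm (Fin n)) (α : (schurSub n B).toSubmodule)
    (t : ⨂[k] _ : Fin n, V),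
      z = schurRep n B σ α ⊗ₜ[k] t - α ⊗ₜ[k] placePerm k n V σ t}

theorem balancedRel_le {V W : ModuleCat.{u} k} (f : V ⟶ W) :
    balancedRel n B V ≤ (balancedRel n B W).comap
      (LinearMap.lTensor _ (PiTensorProduct.map fun _ : Fin n => f.hom)) := by
  refine Submodule.span_le.2 ?_
  rintro _ ⟨σ, α, t, rfl⟩
  refine Submodule.subset_span ⟨σ, α, PiTensorProduct.map (fun _ => f.hom) t, ?_⟩
  rw [map_sub, LinearMap.lTensor_tmul, LinearMap.lTensor_tmul, placePerm_map]

/-- The functor `V ↦ γ_n(B) ⊗_{k(Σ_n)} V^{⊗ n}`. -/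
def schurTensor : ModuleCat.{u} k ⥤ ModuleCat.{u} k where
  obj V := ModuleCat.of k
    (((schurSub n B).toSubmodule ⊗[k] (⨂[k] _ : Fin n, V)) ⧸ balancedRel n B V)
  map f := ModuleCat.ofHom (Submodule.mapQ _ _ _ (balancedRel_le n B f))
  map_id V := by
    ext : 1
    refine Submodule.linearMap_qext _ (TensorProduct.ext' fun α t => ?_)
    have : PiTensorProduct.map (fun _ : Fin n => (𝟙 V : V ⟶ V).hom) t = t := by
      rw [ModuleCat.hom_id, PiTensorProduct.map_id]; rfl
    exact congrArg (fun t' => (balancedRel n B V).mkQ (α ⊗ₜ[k] t')) this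
  map_comp f g := by
    ext : 1
    refine Submodule.linearMap_qext _ (TensorProduct.ext' fun α t => ?_)
    have : PiTensorProduct.map (fun _ : Fin n => (f ≫ g).hom) t
        = PiTensorProduct.map (fun _ : Fin n => g.hom)
          (PiTensorProduct.map (fun _ : Fin n => f.hom) t) :=
      LinearMap.congr_fun (PiTensorProduct.map_comp (fun _ => g.hom) (fun _ => f.hom)) t
    exact congrArg (fun t' => (balancedRel n B _).mkQ (α ⊗ₜ[k] t')) this

end Schur

section Dual

variable {k : Type u} [Field k] (B : ModuleCat.{u} k ⥤ ModuleCat.{u} k)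

/-- `B(V*)*`, which is the value of the dual functor on a finite-dimensional `V`. -/
abbrev DualAt (V : Type u) [AddCommGroup V] [Module k V] : Type u :=
  Module.Dual k (B.obj (ModuleCat.of k (Module.Dual k V)))

/-- The map `B(f*)* : B(V*)* → B(W*)*` induced by `f : V → W`. -/
def dualAtMap {V W : Type u} [AddCommGroup V] [Module k V] [AddCommGroup W] [Module k W]
    (f : V →ₗ[k] W) : DualAt B V →ₗ[k] DualAt B W :=
  (B.map (ModuleCat.ofHom f.dualMap)).hom.dualMap

theorem dualAtMap_id (V : Type u) [AddCommGroup V] [Module k V] :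
    dualAtMap B (LinearMap.id : V →ₗ[k] V) = LinearMap.id := by
  unfold dualAtMap
  rw [LinearMap.dualMap_id, ModuleCat.ofHom_id, B.map_id, ModuleCat.hom_id, LinearMap.dualMap_id]

theorem dualAtMap_comp {U V W : Type u} [AddCommGroup U] [Module k U] [AddCommGroup V]
    [Module k V] [AddCommGroup W] [Module k W] (g : V →ₗ[k] W) (f : U →ₗ[k] V) (x : DualAt B U) :
    dualAtMap B (g ∘ₗ f) x = dualAtMap B g (dualAtMap B f x) := by
  unfold dualAtMap
  rw [← LinearMap.dualMap_comp_dualMap, ModuleCat.ofHom_comp, B.map_comp, ModuleCat.hom_comp,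
    ← LinearMap.dualMap_comp_dualMap]
  rfl

/-- The finite-dimensional submodules of `V`, ordered by inclusion. -/
abbrev FinSub (V : ModuleCat.{u} k) : Type u := {S : Submodule k V // Module.Finite k S}

/-- The direct system `S ↦ B^*(S) = B(S*)*` on the finite-dimensional submodules of `V`. -/
abbrev dualSystem (V : ModuleCat.{u} k) (S T : FinSub V) (h : S ≤ T) :
    DualAt B S.1 →ₗ[k] DualAt B T.1 :=
  dualAtMap B (Submodule.inclusion (show S.1 ≤ T.1 from h))

open Classical in
/-- `B^*(V)`, the direct limit of `B(S*)*` over the finite-dimensional submodules `S` of `V`.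
If `V` itself is finite-dimensional, it is the largest index, and this is `B(V*)*`. -/
abbrev DualObj (V : ModuleCat.{u} k) : Type u :=
  Module.DirectLimit (fun S : FinSub V => DualAt B S.1) (dualSystem B V)

/-- The image of a finite-dimensional submodule. -/
def FinSub.map {V W : ModuleCat.{u} k} (f : V ⟶ W) (S : FinSub V) : FinSub W :=
  ⟨S.1.map f.hom, have := S.2; inferInstance⟩

/-- The restriction `S → f(S)` of `f : V → W`. -/
def FinSub.restr {V W : ModuleCat.{u} k} (f : V ⟶ W) (S : FinSub V) :
    S.1 →ₗ[k] (S.map f).1 :=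
  f.hom.restrict fun _ hx => Submodule.mem_map_of_mem hx

open Classical in
/-- The canonical map `B(S*)* → B^*(V)` for a finite-dimensional submodule `S` of `V`. -/
def dualOf (V : ModuleCat.{u} k) (S : FinSub V) : DualAt B S.1 →ₗ[k] DualObj B V :=
  Module.DirectLimit.of k (FinSub V) (fun S : FinSub V => DualAt B S.1) (dualSystem B V) S

theorem dualOf_system (V : ModuleCat.{u} k) {S T : FinSub V} (h : S ≤ T) (x : DualAt B S.1) :
    dualOf B V T (dualAtMap B (Submodule.inclusion (show S.1 ≤ T.1 from h)) x) =
      dualOf B V S x := by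
  classical
  exact Module.DirectLimit.of_f (f := dualSystem B V) (hij := h)

theorem dualOf_ext {V : ModuleCat.{u} k} {P : Type u} [AddCommGroup P] [Module k P]
    {f g : DualObj B V →ₗ[k] P}
    (h : ∀ S x, f (dualOf B V S x) = g (dualOf B V S x)) : f = g := by
  classical
  exact Module.DirectLimit.hom_ext fun S => LinearMap.ext fun x => h S x

open Classical in
/-- The map `B^*(V) → B^*(W)` induced by `f : V → W`: on the term of a finite-dimensional
submodule `S` of `V` it is the map to the term of `f(S)` induced by the restriction of `f`. -/
def dualObjMap {V W : ModuleCat.{u} k} (f : V ⟶ W) : DualObj B V →ₗ[k] DualObj B W :=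
  Module.DirectLimit.lift k (FinSub V) (fun S : FinSub V => DualAt B S.1) (dualSystem B V)
    (fun S => dualOf B W (S.map f) ∘ₗ dualAtMap B (S.restr f))
    (fun S T h x => by
      have h' : S.map f ≤ T.map f := Submodule.map_mono h
      rw [LinearMap.comp_apply, LinearMap.comp_apply, ← dualOf_system B W h',
        ← dualAtMap_comp, ← dualAtMap_comp]
      rfl)

theorem dualObjMap_of {V W : ModuleCat.{u} k} (f : V ⟶ W) (S : FinSub V) (x : DualAt B S.1) :
    dualObjMap B f (dualOf B V S x) = dualOf B W (S.map f) (dualAtMap B (S.restr f) x) := by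
  classical
  exact Module.DirectLimit.lift_of (R := k) (ι := FinSub V) (f := dualSystem B V) _ _ x

/-- The dual functor `B^*`. -/
def dualFunctor : ModuleCat.{u} k ⥤ ModuleCat.{u} k where
  obj V := ModuleCat.of k (DualObj B V)
  map f := ModuleCat.ofHom (dualObjMap B f)
  map_id V := by
    ext : 1
    refine dualOf_ext B fun S x => ?_
    have h : S.map (𝟙 V) ≤ S := (Submodule.map_id S.1).le
    change dualObjMap B (𝟙 V) (dualOf B V S x) = dualOf B V S x
    rw [dualObjMap_of, ← dualOf_system B V h, ← dualAtMap_comp]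
    have : Submodule.inclusion (show (S.map (𝟙 V)).1 ≤ S.1 from h) ∘ₗ S.restr (𝟙 V) = LinearMap.id := rfl
    rw [this, dualAtMap_id]
    rfl
  map_comp {U V W} f g := by
    ext : 1
    refine dualOf_ext B fun S x => ?_
    have h : S.map (f ≫ g) ≤ (S.map f).map g := (Submodule.map_comp f.hom g.hom S.1).le
    change dualObjMap B (f ≫ g) (dualOf B U S x)
      = dualObjMap B g (dualObjMap B f (dualOf B U S x))
    rw [dualObjMap_of, dualObjMap_of, dualObjMap_of, ← dualOf_system B W h, ← dualAtMap_comp,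
      ← dualAtMap_comp]
    rfl

end Dual

section Projective

variable {k : Type u} [Field k] (n : ℕ)

/-- `B` is `T_n`-projective: there are a free `T_n`-functor `F`, of any rank, and natural
transformations `s : B → F` and `r : F → B` such that `r ∘ s` is a natural equivalence. -/
def IsTnProjective (B : ModuleCat.{u} k ⥤ ModuleCat.{u} k) : Prop :=
  ∃ (J : Type u) (s : B ⟶ freeTensorPow k n J) (r : freeTensorPow k n J ⟶ B), IsIso (s ≫ r)

/-- `B` is (isomorphic to) a subfunctor of a direct sum of finitely many copies of `T_n`. -/
def IsSubfunctor (B : ModuleCat.{u} k ⥤ ModuleCat.{u} k) : Prop :=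
  ∃ (J : Type u) (_ : Finite J) (i : B ⟶ freeTensorPow k n J), Mono i

/-- `B` is (isomorphic to) a quotient functor of a direct sum of finitely many copies
of `T_n`. -/
def IsQuotientFunctor (B : ModuleCat.{u} k ⥤ ModuleCat.{u} k) : Prop :=
  ∃ (J : Type u) (_ : Finite J) (p : freeTensorPow k n J ⟶ B), Epi p

/-- The sub-quotient functors of direct sums of finitely many copies of `T_n`: the quotient
functors of subfunctors of such a direct sum. -/
def IsSubquotient : ObjectProperty (ModuleCat.{u} k ⥤ ModuleCat.{u} k) := fun B =>
  ∃ (D : ModuleCat.{u} k ⥤ ModuleCat.{u} k) (p : D ⟶ B), IsSubfunctor n D ∧ Epi p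

end Projective

end

end TensorFunctor

/-! The subspace γ_n(B) is the image of a projector on B(V̄_n), an alternating sum natural in B, so
γ_n preserves injections and surjections. For a free T_n-functor F the module γ_n(F) is free over
kΣ_n on the tensors x_1 ⊗ ⋯ ⊗ x_n. A transformation F → B is determined by the images of these
generators, and every kΣ_n-map γ_n(F) → γ_n(B) comes from one as soon as B is multilinear
(`IsMultilinear`), a property that passes to subquotients. Maps into a separated functor
(`IsSeparated`), such as a subfunctor of F, are determined by their effect on γ_n. Questions about
functors thus become questions about kΣ_n-modules.

For a retract B of F, evaluation γ_n(B) ⊗ V^{⊗n} → B(V) is inverted by passing through F. For a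
subfunctor of F with γ_n(B) projective, self-injectivity of kΣ_n (`exists_extension_of_projective`)
splits γ_n(B) → γ_n(F), and the splitting lifts to functors. For a quotient, projectivity splits
γ_n(F) → γ_n(B), and the resulting endomorphism of F descends to B. Part 4 extends and lifts maps by
the same means.

For B ≅ B^*: γ_n(B^*) is the contragredient of γ_n(B), so it suffices that finite-dimensional
projective kΣ_n-modules P are self-dual, in any characteristic. Such P are classified by the numbers
dim Hom(P, S), S simple. A trace form on kΣ_n/Ann(S) produces a central element c with Ann(c) =
Ann(S); then kΣ_n·c ≅ S^m with m > 0, and m · dim Hom(P, S) is the rank of c on P. Every permutation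
is conjugate to its inverse, so the coefficients of c are invariant under inversion, and c has the
same rank on P and on its dual (`nonempty_equiv_of_perfect_pairing`). -/

namespace TensorFunctor

noncomputable section

/-! ### Trace forms and annihilators of simple modules -/

section TraceForm

/-- A nonzero finite-dimensional algebra over a field has a nonzero trace form. -/
theorem exists_trace_form (k : Type*) (C : Type*) [Field k] [Ring C] [Algebra k C]
    [Module.Finite k C] [Nontrivial C] :
    ∃ t : C →ₗ[k] k, (∀ a b, t (a * b) = t (b * a)) ∧ t ≠ 0 := by
  classical
  let K := AlgebraicClosure k
  let CK := K ⊗[k] C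
  have : IsArtinianRing CK := IsArtinianRing.of_finite K CK
  have : Nontrivial CK := inferInstance
  -- Over the algebraic closure the semisimple quotient is a product of matrix algebras; the form is
  -- the matrix trace of one factor, brought back to C.
  let R := CK ⧸ Ring.jacobson CK
  have hR : Nontrivial R := Ideal.Quotient.nontrivial_iff.2 (Ring.jacobson_lt_top CK).ne
  obtain ⟨n, d, hd, ⟨e⟩⟩ := IsSemisimpleRing.exists_algEquiv_pi_matrix_of_isAlgClosed K R
  have hn : Nonempty (Fin n) := by
    by_contra h
    rw [not_nonempty_iff] at h
    exact not_subsingleton R e.toEquiv.subsingleton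
  obtain ⟨i⟩ := hn
  let p : CK →ₐ[K] Matrix (Fin (d i)) (Fin (d i)) K :=
    ((Pi.evalAlgHom K (fun i => Matrix (Fin (d i)) (Fin (d i)) K) i).comp e.toAlgHom).comp
      (Ideal.Quotient.mkₐ K (Ring.jacobson CK))
  have hp : Function.Surjective p := fun m => by
    obtain ⟨x, hx⟩ := e.surjective (Pi.single i m)
    obtain ⟨y, rfl⟩ := Ideal.Quotient.mkₐ_surjective K (Ring.jacobson CK) x
    refine ⟨y, ?_⟩
    change e (Ideal.Quotient.mkₐ K (Ring.jacobson CK) y) i = m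
    rw [hx, Pi.single_eq_same]
  let T : CK →ₗ[K] K := Matrix.traceLinearMap (Fin (d i)) K K ∘ₗ p.toLinearMap
  have hT : ∀ a b, T (a * b) = T (b * a) := fun a b => by
    change Matrix.trace (p (a * b)) = Matrix.trace (p (b * a))
    rw [map_mul, map_mul, Matrix.trace_mul_comm]
  -- The elements 1 ⊗ c span the extended algebra over K, and T is nonzero because a matrix unit has
  -- trace 1.
  have hc : ∃ c : C, T (1 ⊗ₜ c) ≠ 0 := by
    by_contra! h
    have h0 : ∀ x, T x = 0 := fun x => by
      induction x using TensorProduct.induction_on with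
      | zero => exact map_zero _
      | tmul a c =>
        rw [show a ⊗ₜ[k] c = a • ((1 : K) ⊗ₜ[k] c) by simp [TensorProduct.smul_tmul'], map_smul,
          h, smul_zero]
      | add x y hx hy => rw [map_add, hx, hy, add_zero]
    obtain ⟨x, hx⟩ := hp (Matrix.single 0 0 1)
    have : T x = 1 := by
      change Matrix.trace (p x) = 1
      rw [hx, Matrix.trace_single_eq_same]
    exact one_ne_zero (this.symm.trans (h0 x))
  obtain ⟨c, hc⟩ := hc
  -- T takes values in K; a k-linear functional on K that is nonzero at one value of T brings them
  -- back to k.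
  obtain ⟨φ, hφ⟩ : ∃ φ : Module.Dual k K, φ (T (1 ⊗ₜ c)) ≠ 0 := by
    by_contra! h
    exact hc ((Module.forall_dual_apply_eq_zero_iff k _).1 h)
  refine ⟨φ ∘ₗ (T.restrictScalars k) ∘ₗ
    (Algebra.TensorProduct.includeRight : C →ₐ[k] CK).toLinearMap, fun a b => ?_, fun h => ?_⟩
  · change φ (T ((Algebra.TensorProduct.includeRight : C →ₐ[k] CK) (a * b)))
      = φ (T ((Algebra.TensorProduct.includeRight : C →ₐ[k] CK) (b * a)))
    rw [map_mul, hT, ← map_mul]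
  · exact hφ (LinearMap.congr_fun h c)

variable {A S : Type*} [Ring A] [AddCommGroup S] [Module A S] [IsSimpleModule A S]

/-- A simple submodule has a nonzero coordinate projection to S, which is an isomorphism by Schur's
lemma. -/
theorem isIsotypicOfType_pi (ι : Type*) : IsIsotypicOfType A (ι → S) S := fun m hm => by
  have : Nontrivial m := IsSimpleModule.nontrivial A m
  obtain ⟨x, hx⟩ := exists_ne (0 : m)
  obtain ⟨i, hi⟩ : ∃ i, (x : ι → S) i ≠ 0 := by
    by_contra! h
    exact hx (Subtype.ext (funext h))
  have h : (LinearMap.proj i : (ι → S) →ₗ[A] S) ∘ₗ m.subtype ≠ 0 := fun h =>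
    hi (LinearMap.congr_fun h x)
  exact ⟨LinearEquiv.ofBijective _ (LinearMap.bijective_of_ne_zero h)⟩

/-- Over a finite-dimensional algebra, the quotient by the annihilator of a simple module `S`
is isomorphic to a finite power of `S`. -/
theorem exists_equiv_pi_of_isSimpleModule (k : Type*) [Field k] [Algebra k A] [Module.Finite k A]
    {N : Type*} [AddCommGroup N] [Module A N] (g : A →ₗ[A] N)
    (hg : ∀ x, g x = 0 ↔ ∀ s : S, x • s = 0) :
    ∃ m : ℕ, m ≠ 0 ∧ Nonempty (LinearMap.range g ≃ₗ[A] (Fin m → S)) := by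
  obtain ⟨s₀, hs₀⟩ : ∃ s : S, s ≠ 0 := @exists_ne _ (IsSimpleModule.nontrivial A S) 0
  have hsurj : Function.Surjective (LinearMap.toSpanSingleton A S s₀) :=
    IsSimpleModule.toSpanSingleton_surjective A hs₀
  let b := Module.finBasis k A
  -- Every element of S has the form a s₀, and x a s₀ is a combination of the x bᵢ s₀, so testing x
  -- on the finitely many bᵢ s₀ already gives the kernel Ann(S).
  let f : A →ₗ[A] (Fin (Module.finrank k A) → S) :=
    LinearMap.pi fun i => LinearMap.toSpanSingleton A S (b i • s₀)
  have hf : LinearMap.ker f = LinearMap.ker g := by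
    ext x
    rw [LinearMap.mem_ker, LinearMap.mem_ker, hg]
    constructor
    · intro h s
      obtain ⟨a, rfl⟩ := hsurj s
      have hi : ∀ i, (x * b i) • s₀ = 0 := fun i => by
        have := congrFun h i
        simpa [f, mul_smul] using this
      have : x * a = ∑ i, b.repr a i • (x * b i) := by
        conv_lhs => rw [← b.sum_repr a, Finset.mul_sum]
        simp only [mul_smul_comm]
      rw [LinearMap.toSpanSingleton_apply, ← mul_smul, this, Finset.sum_smul]
      refine Finset.sum_eq_zero fun i _ => ?_
      rw [Algebra.smul_def, mul_smul, hi, smul_zero]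
    · intro h
      funext i
      simp [f, h]
  have hss : IsSemisimpleModule A (LinearMap.range f) := inferInstance
  have hfin : Module.Finite A (LinearMap.range f) := Module.Finite.range f
  obtain ⟨m, ⟨e⟩⟩ := ((isIsotypicOfType_pi (A := A) (S := S) _).of_injective
    (LinearMap.range f).subtype Subtype.val_injective).linearEquiv_fun
  let E : LinearMap.range g ≃ₗ[A] (Fin m → S) := g.quotKerEquivRange.symm ≪≫ₗ
    Submodule.quotEquivOfEq _ _ hf.symm ≪≫ₗ f.quotKerEquivRange ≪≫ₗ e
  refine ⟨m, ?_, ⟨E⟩⟩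
  rintro rfl
  have h1 : g 1 = 0 := by
    have : (⟨g 1, LinearMap.mem_range_self g 1⟩ : LinearMap.range g) = 0 :=
      E.injective (Subsingleton.elim _ _)
    exact congrArg Subtype.val this
  exact hs₀ (by simpa using (hg 1).1 h1 s₀)

theorem smul_top_pi {A S : Type*} [Ring A] [AddCommGroup S] [Module A S] {N : Ideal A}
    (h : N • (⊤ : Submodule A S) = ⊤) (m : ℕ) :
    N • (⊤ : Submodule A (Fin m → S)) = ⊤ := by
  classical
  rw [eq_top_iff]
  intro v _
  rw [← Finset.univ_sum_single v]
  refine Submodule.sum_mem _ fun i _ => ?_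
  have hv : v i ∈ N • (⊤ : Submodule A S) := by
    rw [h]; exact Submodule.mem_top
  refine Submodule.smul_induction_on hv (fun r hr s _ => ?_) fun x y hx hy => ?_
  · rw [Pi.single_smul]
    exact Submodule.smul_mem_smul hr Submodule.mem_top
  · rw [Pi.single_add]
    exact Submodule.add_mem _ hx hy

/-- The radical of a nonzero trace form on the quotient of a finite-dimensional algebra by the
annihilator of a simple module is that annihilator. -/
theorem annihilator_of_trace_form (k : Type*) [Field k] [Algebra k A] [Module.Finite k A]
    (t : A →ₗ[k] k) (ht : ∀ a b, t (a * b) = t (b * a)) (h0 : t ≠ 0)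
    (hS : ∀ x, (∀ s : S, x • s = 0) → t x = 0) (x : A) (hx : ∀ y, t (y * x) = 0) (s : S) :
    x • s = 0 := by
  -- The radical of the form. It is two-sided by the trace identity (`hN`), and it contains Ann(S).
  let N : Ideal A :=
    { carrier := {x | ∀ y, t (y * x) = 0}
      add_mem' := fun ha hb y => by rw [mul_add, map_add, ha, hb, add_zero]
      zero_mem' := fun y => by rw [mul_zero, map_zero]
      smul_mem' := fun c x hx y => by rw [smul_eq_mul, ← mul_assoc]; exact hx _ }
  have hN : ∀ x ∈ N, ∀ y, x * y ∈ N := fun x hx y z => by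
    rw [← mul_assoc, ht, ← mul_assoc]; exact hx _
  by_contra hs
  have hbot : N • (⊤ : Submodule A S) ≠ ⊥ := fun h => hs <| by
    have : x • s ∈ N • (⊤ : Submodule A S) := Submodule.smul_mem_smul hx Submodule.mem_top
    rwa [h, Submodule.mem_bot] at this
  have htop := (eq_bot_or_eq_top (N • (⊤ : Submodule A S))).resolve_left hbot
  have hI : ∀ x : A, (Module.annihilator A S).mkQ x = 0 ↔ ∀ s : S, x • s = 0 := fun x => by
    rw [Submodule.mkQ_apply, Submodule.Quotient.mk_eq_zero, Module.mem_annihilator]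
  obtain ⟨m, -, ⟨E⟩⟩ := exists_equiv_pi_of_isSimpleModule (S := S) k
    ((Module.annihilator A S).mkQ) hI
  have hm := smul_top_pi htop m
  -- If N does not kill S, then N S = S. As A/Ann(S) is a power of S, N also fills A/Ann(S), so 1
  -- lies in N + Ann(S) = N and the form vanishes.
  let q : A →ₗ[A] (Fin m → S) := E.toLinearMap ∘ₗ ((Module.annihilator A S).mkQ).rangeRestrict
  have hq : ∀ x, q x = 0 → x ∈ N := fun x hx => by
    have h1 : ((Module.annihilator A S).mkQ).rangeRestrict x = 0 := E.injective (by
      rw [map_zero]; exact hx)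
    have h2 := (hI x).1 (congrArg Subtype.val h1)
    intro y
    exact hS _ fun s => by rw [mul_smul, h2, smul_zero]
  have hqs : Function.Surjective q := E.surjective.comp (LinearMap.surjective_rangeRestrict _)
  have hall : ∀ v ∈ N • (⊤ : Submodule A (Fin m → S)), ∃ n ∈ N, q n = v := fun v hv => by
    refine Submodule.smul_induction_on hv (fun r hr w _ => ?_) fun v w hv hw => ?_
    · obtain ⟨a, rfl⟩ := hqs w
      exact ⟨r * a, hN r hr a, by rw [← smul_eq_mul, map_smul]⟩
    · obtain ⟨a, ha, rfl⟩ := hv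
      obtain ⟨b, hb, rfl⟩ := hw
      exact ⟨a + b, N.add_mem ha hb, map_add _ _ _⟩
  obtain ⟨n, hn, hn1⟩ := hall (q 1) (by rw [hm]; exact Submodule.mem_top)
  have h1 : (1 : A) ∈ N := by
    have : (1 - n) ∈ N := hq _ (by rw [map_sub, hn1, sub_self])
    simpa using N.add_mem this hn
  refine h0 (LinearMap.ext fun y => ?_)
  simpa using h1 y

end TraceForm

/-! ### Projective modules are determined by dimensions of maps to simple modules -/

section HomDimension

variable (k : Type u) [Field k] {A : Type u} [Ring A] [Algebra k A]
variable {M M' N S : Type u} [AddCommGroup M] [Module k M] [Module A M] [IsScalarTower k A M]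
  [AddCommGroup M'] [Module k M'] [Module A M'] [IsScalarTower k A M']
  [AddCommGroup N] [Module k N] [Module A N] [IsScalarTower k A N]
  [AddCommGroup S] [Module k S] [Module A S] [IsScalarTower k A S]

/-- Precomposition with an isomorphism, as an isomorphism of `k`-modules. -/
def homCongrLeft (e : M ≃ₗ[A] N) : (N →ₗ[A] S) ≃ₗ[k] (M →ₗ[A] S) where
  toFun f := f ∘ₗ e.toLinearMap
  invFun f := f ∘ₗ e.symm.toLinearMap
  left_inv f := by ext; simp
  right_inv f := by ext; simp
  map_add' _ _ := rfl
  map_smul' _ _ := rfl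

/-- Postcomposition with an isomorphism, as an isomorphism of `k`-modules. -/
def homCongrRight (e : M ≃ₗ[A] N) : (S →ₗ[A] M) ≃ₗ[k] (S →ₗ[A] N) where
  toFun f := e.toLinearMap ∘ₗ f
  invFun f := e.symm.toLinearMap ∘ₗ f
  left_inv f := by ext; simp
  right_inv f := by ext; simp
  map_add' _ _ := by ext; simp
  map_smul' _ _ := by
    ext
    exact (e.toLinearMap.restrictScalars k).map_smul _ _

/-- Linear maps out of a product of two modules. -/
def homProdEquiv : ((M × N) →ₗ[A] S) ≃ₗ[k] (M →ₗ[A] S) × (N →ₗ[A] S) where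
  toFun f := (f ∘ₗ LinearMap.inl A M N, f ∘ₗ LinearMap.inr A M N)
  invFun f := f.1.coprod f.2
  left_inv f := by ext <;> simp
  right_inv f := by ext <;> simp
  map_add' _ _ := rfl
  map_smul' _ _ := rfl

/-- Linear maps into a finite power of a module. -/
def homPiEquiv (m : ℕ) : (M →ₗ[A] (Fin m → S)) ≃ₗ[k] (Fin m → (M →ₗ[A] S)) where
  toFun f i := LinearMap.proj i ∘ₗ f
  invFun f := LinearMap.pi f
  left_inv f := by ext; simp
  right_inv f := by ext; simp
  map_add' _ _ := rfl
  map_smul' _ _ := rfl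

theorem finrank_hom_prod [Module.Finite k M] [Module.Finite k N] [Module.Finite k S] :
    Module.finrank k ((M × N) →ₗ[A] S)
      = Module.finrank k (M →ₗ[A] S) + Module.finrank k (N →ₗ[A] S) := by
  rw [(homProdEquiv k).finrank_eq, Module.finrank_prod]

theorem exists_hom_ne_zero_of_finrank_eq [Module.Finite k M] [Module.Finite k N]
    [Module.Finite k S] (h : Module.finrank k (M →ₗ[A] S) = Module.finrank k (N →ₗ[A] S))
    {f : M →ₗ[A] S} (hf : f ≠ 0) : ∃ g : N →ₗ[A] S, g ≠ 0 := by
  have : Nontrivial (M →ₗ[A] S) := ⟨f, 0, hf⟩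
  have h1 : 0 < Module.finrank k (M →ₗ[A] S) := Module.finrank_pos
  rw [h] at h1
  have := Module.nontrivial_of_finrank_pos h1
  exact exists_ne 0

theorem exists_hom_simple_ne_zero [IsSemisimpleModule A M] [Nontrivial M] :
    ∃ (S : Submodule A M) (_ : IsSimpleModule A S) (f : M →ₗ[A] S),
      f ∘ₗ S.subtype = LinearMap.id := by
  obtain ⟨S, hS⟩ := IsSemisimpleModule.exists_simple_submodule A M
  obtain ⟨f, hf⟩ := IsSemisimpleModule.extension_property S.subtype
    S.subtype_injective LinearMap.id
  exact ⟨S, hS, f, hf⟩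

/-- A split epimorphism identifies its source with the product of target and kernel. -/
theorem nonempty_equiv_prod_ker {A M S : Type*} [Ring A] [AddCommGroup M] [Module A M]
    [AddCommGroup S] [Module A S] (f : M →ₗ[A] S) (s : S →ₗ[A] M) (h : f ∘ₗ s = LinearMap.id) :
    Nonempty (M ≃ₗ[A] S × LinearMap.ker f) := by
  have hx : ∀ x, f (s x) = x := fun x => LinearMap.congr_fun h x
  refine ⟨LinearEquiv.ofBijective (f.prod ((LinearMap.id - s ∘ₗ f).codRestrict
    (LinearMap.ker f) fun x => by simp [hx])) ⟨fun x y hxy => ?_, fun y => ?_⟩⟩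
  · have h1 : f x = f y := congrArg Prod.fst hxy
    have h2 : x - s (f x) = y - s (f y) := congrArg (fun z => (z.2 : M)) hxy
    rwa [h1, sub_left_inj] at h2
  · obtain ⟨y, z, hz⟩ := y
    refine ⟨s y + z, Prod.ext ?_ (Subtype.ext ?_)⟩
    · simp [hx, LinearMap.mem_ker.1 hz]
    · simp [hx, LinearMap.mem_ker.1 hz]

/-- Finite-dimensional semisimple modules with the same dimensions of spaces of maps to all
simple modules are isomorphic. -/
theorem nonempty_equiv_of_finrank_hom (d : ℕ) :
    ∀ (M N : Type u) [AddCommGroup M] [Module k M] [Module A M] [IsScalarTower k A M]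
    [AddCommGroup N] [Module k N] [Module A N] [IsScalarTower k A N]
    [Module.Finite k M] [Module.Finite k N] [IsSemisimpleModule A M] [IsSemisimpleModule A N]
    (_ : ∀ (S : Type u) [AddCommGroup S] [Module k S] [Module A S] [IsScalarTower k A S]
      [Module.Finite k S] [IsSimpleModule A S],
      Module.finrank k (M →ₗ[A] S) = Module.finrank k (N →ₗ[A] S))
    (_ : Module.finrank k M = d), Nonempty (M ≃ₗ[A] N) := by
  induction d using Nat.strong_induction_on with
  | _ d ih =>
  intro M N _ _ _ _ _ _ _ _ _ _ _ _ h hd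
  rcases subsingleton_or_nontrivial M with hM | hM
  · rcases subsingleton_or_nontrivial N with hN | hN
    · exact ⟨0⟩
    · obtain ⟨S, hS, f, hf⟩ := exists_hom_simple_ne_zero (A := A) (M := N)
      have : Nontrivial S := IsSimpleModule.nontrivial A S
      have hf0 : f ≠ 0 := by
        rintro rfl
        obtain ⟨x, hx⟩ := exists_ne (0 : S)
        exact hx (LinearMap.congr_fun hf x).symm
      have : Module.Finite k S := Module.Finite.of_injective
        (S.subtype.restrictScalars k) Subtype.val_injective
      obtain ⟨g, hg⟩ := exists_hom_ne_zero_of_finrank_eq k (h S).symm hf0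
      exact (hg (LinearMap.ext fun x => by rw [Subsingleton.elim x 0, map_zero, map_zero])).elim
  · obtain ⟨S, hS, f, hf⟩ := exists_hom_simple_ne_zero (A := A) (M := M)
    have : Nontrivial S := IsSimpleModule.nontrivial A S
    have hf0 : f ≠ 0 := by
      rintro rfl
      obtain ⟨x, hx⟩ := exists_ne (0 : S)
      exact hx (LinearMap.congr_fun hf x).symm
    have : Module.Finite k S := Module.Finite.of_injective
      (S.subtype.restrictScalars k) Subtype.val_injective
    obtain ⟨g, hg⟩ := exists_hom_ne_zero_of_finrank_eq k (h S) hf0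
    -- Both modules split off a copy of S. The additive Hom dimensions of the complements still
    -- agree, so induction on the dimension applies to the kernels.
    obtain ⟨s, hs⟩ := IsSemisimpleModule.lifting_property g
      (LinearMap.surjective_of_ne_zero hg) LinearMap.id
    obtain ⟨e⟩ := nonempty_equiv_prod_ker f _ hf
    obtain ⟨e'⟩ := nonempty_equiv_prod_ker g _ hs
    have : Module.Finite k (LinearMap.ker f) := Module.Finite.of_injective
      ((LinearMap.ker f).subtype.restrictScalars k) Subtype.val_injective
    have : Module.Finite k (LinearMap.ker g) := Module.Finite.of_injective
      ((LinearMap.ker g).subtype.restrictScalars k) Subtype.val_injective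
    have hdim : Module.finrank k (LinearMap.ker f) < d := by
      have h1 := (e.restrictScalars k).finrank_eq
      rw [Module.finrank_prod] at h1
      have h2 : 0 < Module.finrank k S := Module.finrank_pos
      omega
    obtain ⟨e''⟩ := ih _ hdim (LinearMap.ker f) (LinearMap.ker g) (fun T _ _ _ _ _ _ => by
      have h1 := h T
      rw [← (homCongrLeft k e).finrank_eq, ← (homCongrLeft k e').finrank_eq,
        finrank_hom_prod, finrank_hom_prod] at h1
      omega) rfl
    exact ⟨e ≪≫ₗ (LinearEquiv.refl A S).prodCongr e'' ≪≫ₗ e'.symm⟩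

/-- Maps from the top of a module to a simple module. -/
def homTopEquiv [IsSimpleModule A S] :
    ((M ⧸ Module.jacobson A M) →ₗ[A] S) ≃ₗ[k] (M →ₗ[A] S) where
  toFun f := f ∘ₗ (Module.jacobson A M).mkQ
  invFun f := (Module.jacobson A M).liftQ f (IsSemisimpleModule.jacobson_le_ker A A M S f)
  left_inv f := by ext; simp
  right_inv f := by ext; simp
  map_add' _ _ := rfl
  map_smul' _ _ := rfl

/-- Nakayama's argument: a maximal submodule containing the image of f also contains the radical,
hence everything. -/
theorem surjective_of_top {A M N : Type*} [Ring A] [AddCommGroup M] [Module A M] [AddCommGroup N]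
    [Module A N] [Module.Finite A N] (f : M →ₗ[A] N)
    (h : Function.Surjective ((Module.jacobson A N).mkQ ∘ₗ f)) : Function.Surjective f := by
  rw [← LinearMap.range_eq_top]
  by_contra hf
  obtain ⟨m, hm, hfm⟩ := (eq_top_or_exists_le_coatom (LinearMap.range f)).resolve_left hf
  refine hm.1 (eq_top_iff.2 fun y _ => ?_)
  obtain ⟨x, hx⟩ := h ((Module.jacobson A N).mkQ y)
  have h1 : f x - y ∈ Module.jacobson A N := by
    rw [← Submodule.Quotient.mk_eq_zero, ← Submodule.mkQ_apply, map_sub]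
    exact sub_eq_zero.2 hx
  have h2 : f x - y ∈ m := (sInf_le hm : Module.jacobson A N ≤ m) h1
  have h3 : f x ∈ m := hfm (LinearMap.mem_range_self f x)
  simpa using m.sub_mem h3 h2

/-- Finite-dimensional projective modules with isomorphic tops are isomorphic. -/
theorem nonempty_equiv_of_top_equiv [Module.Finite k M] [Module.Finite k N]
    [Module.Projective A M] [Module.Projective A N]
    (e : (M ⧸ Module.jacobson A M) ≃ₗ[A] (N ⧸ Module.jacobson A N)) :
    Nonempty (M ≃ₗ[A] N) := by
  have : Module.Finite A M := Module.Finite.of_restrictScalars_finite k A M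
  have : Module.Finite A N := Module.Finite.of_restrictScalars_finite k A N
  obtain ⟨f, hf⟩ := Module.projective_lifting_property (Module.jacobson A N).mkQ
    (e.toLinearMap ∘ₗ (Module.jacobson A M).mkQ) (Submodule.mkQ_surjective _)
  obtain ⟨g, hg⟩ := Module.projective_lifting_property (Module.jacobson A M).mkQ
    (e.symm.toLinearMap ∘ₗ (Module.jacobson A N).mkQ) (Submodule.mkQ_surjective _)
  have hfs : Function.Surjective f := surjective_of_top f (by
    rw [hf]; exact e.surjective.comp (Submodule.mkQ_surjective _))
  have hgs : Function.Surjective g := surjective_of_top g (by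
    rw [hg]; exact e.symm.surjective.comp (Submodule.mkQ_surjective _))
  -- Surjections in both directions force equal dimensions, after which f is bijective; f and g need
  -- not be mutually inverse.
  have hdim : Module.finrank k M = Module.finrank k N := le_antisymm
    (LinearMap.finrank_le_finrank_of_surjective (f := g.restrictScalars k) hgs)
    (LinearMap.finrank_le_finrank_of_surjective (f := f.restrictScalars k) hfs)
  exact ⟨LinearEquiv.ofBijective f
    ⟨(LinearMap.injective_iff_surjective_of_finrank_eq_finrank (f := f.restrictScalars k) hdim).2
      hfs, hfs⟩⟩

theorem finite_quotient [Module.Finite k M] (P : Submodule A M) : Module.Finite k (M ⧸ P) :=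
  Module.Finite.of_surjective (P.mkQ.restrictScalars k) (Submodule.mkQ_surjective _)

theorem isSemisimpleModule_top [Module.Finite k A] [Module.Finite k M] :
    IsSemisimpleModule A (M ⧸ Module.jacobson A M) := by
  have : IsArtinianRing A := IsArtinianRing.of_finite k A
  have : Module.Finite A M := Module.Finite.of_restrictScalars_finite k A M
  exact (IsArtinian.isSemisimpleModule_iff_jacobson A _).2 (Module.jacobson_quotient_jacobson A M)

/-- Finite-dimensional projective modules with the same dimensions of spaces of maps to all
simple modules are isomorphic. -/
theorem nonempty_equiv_of_projective [Module.Finite k A] [Module.Finite k M] [Module.Finite k N]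
    [Module.Projective A M] [Module.Projective A N]
    (h : ∀ (S : Type u) [AddCommGroup S] [Module k S] [Module A S] [IsScalarTower k A S]
      [Module.Finite k S] [IsSimpleModule A S],
      Module.finrank k (M →ₗ[A] S) = Module.finrank k (N →ₗ[A] S)) :
    Nonempty (M ≃ₗ[A] N) := by
  have := isSemisimpleModule_top k (A := A) (M := M)
  have := isSemisimpleModule_top k (A := A) (M := N)
  have := finite_quotient k (Module.jacobson A M)
  have := finite_quotient k (Module.jacobson A N)
  have key := nonempty_equiv_of_finrank_hom k (A := A)
    (Module.finrank k (M ⧸ Module.jacobson A M)) (M ⧸ Module.jacobson A M)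
    (N ⧸ Module.jacobson A N) (fun S _ _ _ _ _ _ =>
      (homTopEquiv k).finrank_eq.trans ((h S).trans (homTopEquiv k).finrank_eq.symm)) rfl
  exact key.elim fun e => nonempty_equiv_of_top_equiv k e

end HomDimension

/-! ### Group algebras: central elements, self-injectivity and self-duality of projectives -/

section GroupAlgebra

variable {k : Type u} [Field k] {G : Type} [Group G] [Fintype G]

theorem sum_single_coeff {G : Type*} [Fintype G] (x : MonoidAlgebra k G) :
    ∑ g, MonoidAlgebra.single g (x.coeff g) = x := by
  classical
  ext h
  simp [MonoidAlgebra.coeff_sum]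

/-- The element `∑ t(g⁻¹) g` of the group algebra that belongs to a linear functional `t`. -/
def dualElement (t : MonoidAlgebra k G →ₗ[k] k) : MonoidAlgebra k G :=
  ∑ g, MonoidAlgebra.single g (t (MonoidAlgebra.single g⁻¹ 1))

theorem coeff_dualElement (t : MonoidAlgebra k G →ₗ[k] k) (g : G) :
    (dualElement t).coeff g = t (MonoidAlgebra.single g⁻¹ 1) := by
  classical
  simp [dualElement, MonoidAlgebra.coeff_sum, Finsupp.single_apply]

theorem coeff_mul_dualElement (t : MonoidAlgebra k G →ₗ[k] k) (x : MonoidAlgebra k G) (g : G) :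
    (x * dualElement t).coeff g = t (MonoidAlgebra.single g⁻¹ 1 * x) := by
  classical
  rw [← sum_single_coeff x, Finset.sum_mul, Finset.mul_sum, map_sum, MonoidAlgebra.coeff_sum,
    Finsupp.finsetSum_apply]
  refine Finset.sum_congr rfl fun h _ => ?_
  rw [MonoidAlgebra.coeff_single_mul_apply, coeff_dualElement, MonoidAlgebra.single_mul_single,
    one_mul, mul_inv_rev, inv_inv]
  have : MonoidAlgebra.single (g⁻¹ * h) (x.coeff h)
      = x.coeff h • MonoidAlgebra.single (g⁻¹ * h) (1 : k) := by simp
  rw [this, map_smul, smul_eq_mul]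

/-- The coefficient of the product at g is t(g⁻¹ x), and the group elements span the algebra. The
radical of the form t thereby becomes the annihilator of a single element. -/
theorem mul_dualElement_eq_zero_iff (t : MonoidAlgebra k G →ₗ[k] k) (x : MonoidAlgebra k G) :
    x * dualElement t = 0 ↔ ∀ y, t (y * x) = 0 := by
  constructor
  · intro h y
    rw [← sum_single_coeff y, Finset.sum_mul, map_sum]
    refine Finset.sum_eq_zero fun g _ => ?_
    have h1 := coeff_mul_dualElement t x g⁻¹
    rw [h, inv_inv] at h1
    have : MonoidAlgebra.single g (y.coeff g)
      = y.coeff g • MonoidAlgebra.single g (1 : k) := by simp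
    rw [this, smul_mul_assoc, map_smul, ← h1]
    simp
  · intro h
    ext g
    rw [coeff_mul_dualElement, h]
    rfl

/-- If every element of a finite group is conjugate to its inverse, then the annihilator of a
simple module is the annihilator of a central element with `c(g⁻¹) = c(g)`. -/
theorem exists_central_element (hG : ∀ g : G, IsConj g g⁻¹)
    (S : Type*) [AddCommGroup S] [Module (MonoidAlgebra k G) S]
    [IsSimpleModule (MonoidAlgebra k G) S] :
    ∃ c : MonoidAlgebra k G, (∀ x, c * x = x * c) ∧ (∀ g, c.coeff g⁻¹ = c.coeff g) ∧
      ∀ x, x * c = 0 ↔ ∀ s : S, x • s = 0 := by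
  have : Module.Finite k (MonoidAlgebra k G) :=
    Module.Finite.equiv (MonoidAlgebra.coeffLinearEquiv k).symm
  let I := Module.annihilator (MonoidAlgebra k G) S
  have hI : Nontrivial (MonoidAlgebra k G ⧸ I) := by
    refine Ideal.Quotient.nontrivial_iff.2 fun h => ?_
    have : Nontrivial S := IsSimpleModule.nontrivial (MonoidAlgebra k G) S
    obtain ⟨s, hs⟩ := exists_ne (0 : S)
    have h1 : (1 : MonoidAlgebra k G) ∈ I := h ▸ Submodule.mem_top
    exact hs (by simpa using Module.mem_annihilator.1 h1 s)
  have : Module.Finite k (MonoidAlgebra k G ⧸ I) := Module.Finite.of_surjective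
    (Ideal.Quotient.mkₐ k I).toLinearMap (Ideal.Quotient.mkₐ_surjective k I)
  -- A trace form on k[G]/Ann(S), pulled back to k[G]. It vanishes on Ann(S), so its radical is
  -- exactly Ann(S), and as a trace it is constant on conjugacy classes.
  obtain ⟨t', ht', ht0⟩ := exists_trace_form k (MonoidAlgebra k G ⧸ I)
  let t : MonoidAlgebra k G →ₗ[k] k := t' ∘ₗ (Ideal.Quotient.mkₐ k I).toLinearMap
  have ht : ∀ a b, t (a * b) = t (b * a) := fun a b => by
    change t' (Ideal.Quotient.mkₐ k I (a * b)) = t' (Ideal.Quotient.mkₐ k I (b * a))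
    rw [map_mul, ht', ← map_mul]
  have hne : t ≠ 0 := fun h => ht0 (LinearMap.ext fun y => by
    obtain ⟨x, rfl⟩ := Ideal.Quotient.mkₐ_surjective k I y
    exact LinearMap.congr_fun h x)
  have hS : ∀ x, (∀ s : S, x • s = 0) → t x = 0 := fun x hx => by
    have : Ideal.Quotient.mkₐ k I x = 0 :=
      Ideal.Quotient.eq_zero_iff_mem.2 (Module.mem_annihilator.2 hx)
    change t' (Ideal.Quotient.mkₐ k I x) = 0
    rw [this, map_zero]
  have hconj : ∀ g h : G, IsConj g h →
      t (MonoidAlgebra.single g 1) = t (MonoidAlgebra.single h 1) := fun g h hgh => by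
    obtain ⟨c, rfl⟩ := isConj_iff.1 hgh
    have h1 : MonoidAlgebra.single (c * g * c⁻¹) (1 : k)
        = MonoidAlgebra.single (c * g) 1 * MonoidAlgebra.single c⁻¹ 1 := by
      rw [MonoidAlgebra.single_mul_single, one_mul]
    rw [h1, ht, MonoidAlgebra.single_mul_single, one_mul, inv_mul_cancel_left]
  have hx : ∀ x, x * dualElement t = 0 ↔ ∀ s : S, x • s = 0 := fun x => by
    rw [mul_dualElement_eq_zero_iff]
    refine ⟨fun h s => annihilator_of_trace_form k t ht hne hS x h s, fun h y => hS _ fun s => ?_⟩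
    rw [mul_smul, h, smul_zero]
  refine ⟨dualElement t, fun x => ?_, fun g => ?_, hx⟩
  · rw [← sum_single_coeff x, Finset.sum_mul, Finset.mul_sum]
    refine Finset.sum_congr rfl fun h _ => ?_
    ext g
    rw [MonoidAlgebra.coeff_mul_single_apply, MonoidAlgebra.coeff_single_mul_apply,
      coeff_dualElement, coeff_dualElement, mul_comm]
    congr 1
    -- The two values of t are taken at h g⁻¹ and g⁻¹ h, which are conjugate by h⁻¹.
    refine hconj _ _ (isConj_iff.2 ⟨h⁻¹, ?_⟩)
    group
  · rw [coeff_dualElement, coeff_dualElement, inv_inv]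
    exact hconj _ _ (hG g)

variable {M N P Q : Type u} [AddCommGroup M] [Module k M] [Module (MonoidAlgebra k G) M]
  [IsScalarTower k (MonoidAlgebra k G) M]
  [AddCommGroup N] [Module k N] [Module (MonoidAlgebra k G) N]
  [IsScalarTower k (MonoidAlgebra k G) N]
  [AddCommGroup P] [Module k P] [Module (MonoidAlgebra k G) P]
  [IsScalarTower k (MonoidAlgebra k G) P]
  [AddCommGroup Q] [Module k Q] [Module (MonoidAlgebra k G) Q]
  [IsScalarTower k (MonoidAlgebra k G) Q]

variable (k) in
/-- Scalar multiplication by an element of the group algebra as a `k`-linear map. -/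
def smulMap (a : MonoidAlgebra k G) : M →ₗ[k] M where
  toFun x := a • x
  map_add' := smul_add a
  map_smul' r x := by rw [smul_comm]; rfl

/-- The linear map to the group algebra with coefficients `φ(g⁻¹ x)`. -/
def coextendLin (φ : Module.Dual k M) : M →ₗ[k] MonoidAlgebra k G :=
  (MonoidAlgebra.coeffLinearEquiv k).symm.toLinearMap ∘ₗ
    (Finsupp.linearEquivFunOnFinite k k G).symm.toLinearMap ∘ₗ
    LinearMap.pi fun g : G => φ ∘ₗ smulMap k (MonoidAlgebra.single g⁻¹ 1)

theorem coeff_coextendLin (φ : Module.Dual k M) (x : M) (g : G) :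
    (coextendLin φ x).coeff g = φ (MonoidAlgebra.single g⁻¹ (1 : k) • x) := rfl

/-- Linear maps to the group algebra are the same as linear functionals. -/
def coextend : Module.Dual k M ≃ₗ[k] (M →ₗ[MonoidAlgebra k G] MonoidAlgebra k G) where
  toFun φ := MonoidAlgebra.equivariantOfLinearOfComm (coextendLin φ) (fun h x => by
    ext g
    rw [smul_eq_mul, MonoidAlgebra.coeff_single_mul_apply, coeff_coextendLin, coeff_coextendLin,
      ← mul_smul, MonoidAlgebra.single_mul_single, mul_inv_rev, inv_inv, one_mul, one_mul])
  invFun f := (Finsupp.lapply 1 ∘ₗ (MonoidAlgebra.coeffLinearEquiv k).toLinearMap) ∘ₗ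
    f.restrictScalars k
  left_inv φ := by
    ext x
    change (coextendLin φ x).coeff (1 : G) = φ x
    rw [coeff_coextendLin, inv_one, ← MonoidAlgebra.one_def, one_smul]
  right_inv f := by
    ext x g
    change (f (MonoidAlgebra.single g⁻¹ (1 : k) • x)).coeff 1 = (f x).coeff g
    rw [map_smul, smul_eq_mul, MonoidAlgebra.coeff_single_mul_apply, inv_inv, mul_one, one_mul]
  map_add' φ ψ := by
    ext x g
    rfl
  map_smul' r φ := by
    ext x g
    rfl

theorem coeff_coextend (φ : Module.Dual k M) (x : M) (g : G) :
    (coextend φ x).coeff g = φ (MonoidAlgebra.single g⁻¹ (1 : k) • x) := rfl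

/-- Under the identification of M* with Hom(M, k[G]), the transpose of c becomes multiplication by c
on the target. Centrality lets c move from one side to the other. -/
theorem coextend_smul (φ : Module.Dual k M) (c : MonoidAlgebra k G) (hc : ∀ x, c * x = x * c) :
    coextend (φ ∘ₗ smulMap k c) = LinearMap.toSpanSingleton (MonoidAlgebra k G) _ c ∘ₗ
      (coextend φ : M →ₗ[MonoidAlgebra k G] MonoidAlgebra k G) := by
  ext x g
  rw [LinearMap.comp_apply, LinearMap.toSpanSingleton_apply, smul_eq_mul, ← hc, ← smul_eq_mul,
    ← map_smul, coeff_coextend, coeff_coextend, ← mul_smul, ← hc, mul_smul]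
  rfl

/-- The group algebra of a finite group is self-injective. -/
theorem exists_extension_of_projective [Module.Finite k P]
    [Module.Projective (MonoidAlgebra k G) P] (i : M →ₗ[MonoidAlgebra k G] N)
    (hi : Function.Injective i) (f : M →ₗ[MonoidAlgebra k G] P) :
    ∃ g : N →ₗ[MonoidAlgebra k G] P, g ∘ₗ i = f := by
  have : Module.Finite (MonoidAlgebra k G) P := Module.Finite.of_restrictScalars_finite k _ P
  obtain ⟨n, p, hp⟩ := Module.Finite.exists_fin' (MonoidAlgebra k G) P
  obtain ⟨s, hs⟩ := Module.projective_lifting_property p LinearMap.id hp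
  -- P is a summand of a finite free module, so it suffices to extend each coordinate. A coordinate
  -- is a map to k[G], that is a linear functional, and functionals extend through a k-linear left
  -- inverse of i.
  have key : ∀ j, ∃ g : N →ₗ[MonoidAlgebra k G] MonoidAlgebra k G,
      g ∘ₗ i = LinearMap.proj j ∘ₗ s ∘ₗ f := fun j => by
    obtain ⟨φ, hφ⟩ := coextend.surjective (LinearMap.proj j ∘ₗ s ∘ₗ f)
    obtain ⟨r, hr⟩ := (i.restrictScalars k).exists_leftInverse_of_injective
      (LinearMap.ker_eq_bot.2 hi)
    refine ⟨coextend (φ ∘ₗ r), ?_⟩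
    rw [← hφ]
    ext x g
    rw [LinearMap.comp_apply, coeff_coextend, coeff_coextend, ← map_smul]
    exact congrArg φ (LinearMap.congr_fun hr _)
  choose g hg using key
  refine ⟨p ∘ₗ LinearMap.pi g, LinearMap.ext fun x => ?_⟩
  have h1 : LinearMap.pi g (i x) = s (f x) := funext fun j => LinearMap.congr_fun (hg j) x
  rw [LinearMap.comp_apply, LinearMap.comp_apply, h1]
  exact LinearMap.congr_fun hs (f x)

/-- Maps from a projective module to the left ideal of a central element. -/
theorem finrank_hom_range [Module.Projective (MonoidAlgebra k G) P] (c : MonoidAlgebra k G)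
    (hc : ∀ x, c * x = x * c) :
    Module.finrank k (P →ₗ[MonoidAlgebra k G]
        LinearMap.range (LinearMap.toSpanSingleton (MonoidAlgebra k G) (MonoidAlgebra k G) c)) =
      Module.finrank k (LinearMap.range (smulMap k c : P →ₗ[k] P)) := by
  let L := LinearMap.toSpanSingleton (MonoidAlgebra k G) (MonoidAlgebra k G) c
  let j : (P →ₗ[MonoidAlgebra k G] LinearMap.range L) →ₗ[k]
      (P →ₗ[MonoidAlgebra k G] MonoidAlgebra k G) :=
    { toFun := fun f => (LinearMap.range L).subtype ∘ₗ f
      map_add' := fun _ _ => rfl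
      map_smul' := fun _ _ => rfl }
  have hj : Function.Injective j := fun f g h => LinearMap.ext fun x =>
    Subtype.ext (LinearMap.congr_fun h x)
  -- Projectivity lifts a map P → k[G]c along k[G] → k[G]c. So these maps are the multiples by c of
  -- maps P → k[G], that is the image of the transpose of c on P*.
  have hr : LinearMap.range j = (LinearMap.range (smulMap k c : P →ₗ[k] P).dualMap).map
      (coextend (G := G) (M := P)).toLinearMap := by
    ext f
    constructor
    · rintro ⟨f, rfl⟩
      obtain ⟨f', hf'⟩ := Module.projective_lifting_property L.rangeRestrict f
        L.surjective_rangeRestrict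
      refine ⟨_, ⟨coextend.symm f', rfl⟩, ?_⟩
      change coextend (coextend.symm f' ∘ₗ smulMap k c) = _
      rw [coextend_smul _ _ hc, LinearEquiv.apply_symm_apply, ← hf']
      rfl
    · rintro ⟨_, ⟨φ, rfl⟩, rfl⟩
      refine ⟨L.rangeRestrict ∘ₗ coextend φ, ?_⟩
      exact (coextend_smul φ c hc).symm
  rw [← LinearMap.finrank_range_of_inj hj, hr, ← LinearMap.finrank_range_dualMap_eq_finrank_range]
  exact LinearEquiv.finrank_map_eq (coextend (G := G) (M := P)) _

/-- If every element of a finite group is conjugate to its inverse, then finite-dimensional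
projective modules in duality are isomorphic. -/
theorem nonempty_equiv_of_perfect_pairing (hG : ∀ g : G, IsConj g g⁻¹)
    [Module.Finite k P] [Module.Finite k Q]
    [Module.Projective (MonoidAlgebra k G) P] [Module.Projective (MonoidAlgebra k G) Q]
    (β : P ≃ₗ[k] Module.Dual k Q)
    (hβ : ∀ (g : G) (x : P) (y : Q), β (MonoidAlgebra.single g (1 : k) • x) y
      = β x (MonoidAlgebra.single g⁻¹ (1 : k) • y)) :
    Nonempty (P ≃ₗ[MonoidAlgebra k G] Q) := by
  have : Module.Finite k (MonoidAlgebra k G) :=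
    Module.Finite.equiv (MonoidAlgebra.coeffLinearEquiv k).symm
  refine nonempty_equiv_of_projective k fun S _ _ _ _ _ _ => ?_
  obtain ⟨c, hc, hinv, hker⟩ := exists_central_element (k := k) hG S
  obtain ⟨m, hm, ⟨E⟩⟩ := exists_equiv_pi_of_isSimpleModule (S := S) k
    (LinearMap.toSpanSingleton (MonoidAlgebra k G) (MonoidAlgebra k G) c) hker
  -- Since c(g⁻¹) = c(g), the pairing makes the action of c on P the transpose of its action on Q;
  -- transposes have equal rank.
  have hdim : Module.finrank k (LinearMap.range (smulMap k c : P →ₗ[k] P))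
      = Module.finrank k (LinearMap.range (smulMap k c : Q →ₗ[k] Q)) := by
    have h1 : β.toLinearMap ∘ₗ smulMap k c = (smulMap k c : Q →ₗ[k] Q).dualMap ∘ₗ
        β.toLinearMap := by
      ext x y
      change β (c • x) y = β x (c • y)
      rw [← sum_single_coeff c, Finset.sum_smul, Finset.sum_smul, map_sum, map_sum,
        LinearMap.sum_apply]
      refine Fintype.sum_equiv (Equiv.inv G) _ _ fun g => ?_
      have h2 : ∀ (g : G) (r : k), MonoidAlgebra.single g r
        = r • MonoidAlgebra.single g (1 : k) := fun g r => by simp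
      rw [Equiv.inv_apply, hinv, h2, h2 g⁻¹, smul_assoc, smul_assoc, β.map_smul,
        (β x).map_smul, LinearMap.smul_apply, hβ]
    rw [← LinearMap.finrank_range_dualMap_eq_finrank_range (smulMap k c : Q →ₗ[k] Q)]
    have h3 : LinearMap.range (smulMap k c : Q →ₗ[k] Q).dualMap
        = (LinearMap.range (smulMap k c : P →ₗ[k] P)).map β.toLinearMap := by
      rw [← LinearMap.range_comp, h1, LinearMap.range_comp_of_range_eq_top _ β.range]
    rw [h3]
    exact (LinearEquiv.finrank_map_eq β _).symm
  -- The left ideal generated by c is S^m, so the rank of c on a projective module counts the maps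
  -- to S with the factor m, which is nonzero and cancels.
  have hmul : ∀ (R : Type u) [AddCommGroup R] [Module k R] [Module (MonoidAlgebra k G) R]
      [IsScalarTower k (MonoidAlgebra k G) R] [Module.Finite k R]
      [Module.Projective (MonoidAlgebra k G) R],
      Module.finrank k (LinearMap.range (smulMap k c : R →ₗ[k] R))
        = m * Module.finrank k (R →ₗ[MonoidAlgebra k G] S) := fun R _ _ _ _ _ _ => by
    rw [← finrank_hom_range c hc, ((homCongrRight k E).trans (homPiEquiv k m)).finrank_eq,
      Module.finrank_pi_fintype, Finset.sum_const, Finset.card_univ, Fintype.card_fin,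
      smul_eq_mul]
  rw [hmul, hmul] at hdim
  exact Nat.eq_of_mul_eq_mul_left (Nat.pos_of_ne_zero hm) hdim

/-- A permutation and its inverse have the same cycle type. Self-duality of projectives uses no
other special property of symmetric groups. -/
theorem isConj_inv_perm {α : Type*} [Fintype α] [DecidableEq α] (σ : Equiv.Perm α) :
    IsConj σ σ⁻¹ := by
  rw [Equiv.Perm.isConj_iff_cycleType_eq, Equiv.Perm.cycleType_inv]

end GroupAlgebra

/-! ### The natural projector onto γ_n -/

section Projector

variable {k : Type u} [Field k] {n : ℕ}

/-- The linear map `x_i ↦ v_i`. -/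
def linMap {V : ModuleCat.{u} k} (v : Fin n → V) : stdMod k n ⟶ V :=
  ModuleCat.ofHom ((Pi.basisFun k (Fin n)).constr k v)

theorem linMap_single {V : ModuleCat.{u} k} (v : Fin n → V) (j : Fin n) :
    (linMap v).hom (Pi.single j 1) = v j := by
  have := (Pi.basisFun k (Fin n)).constr_basis k v j
  rwa [Pi.basisFun_apply] at this

theorem linMap_comp {V W : ModuleCat.{u} k} (v : Fin n → V) (f : V ⟶ W) :
    linMap v ≫ f = linMap fun i => f.hom (v i) :=
  stdMod_hom_ext k fun j => by
    rw [ModuleCat.hom_comp, LinearMap.comp_apply, linMap_single, linMap_single]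

theorem permMap_linMap {V : ModuleCat.{u} k} (v : Fin n → V) (σ : Equiv.Perm (Fin n)) :
    permMap k σ ≫ linMap v = linMap fun i => v (σ i) :=
  stdMod_hom_ext k fun j => by
    rw [ModuleCat.hom_comp, LinearMap.comp_apply, permMap_single, linMap_single, linMap_single]

variable (k) in
/-- The projection of `V̄_n` that maps `x_i` to `0` for `i ∈ U`. -/
def zeroOut (U : Finset (Fin n)) : stdMod k n ⟶ stdMod k n :=
  linMap fun j => if j ∈ U then (0 : Fin n → k) else Pi.single j 1

theorem zeroOut_single (U : Finset (Fin n)) (j : Fin n) :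
    (zeroOut k U).hom (Pi.single j 1) = if j ∈ U then (0 : Fin n → k) else Pi.single j 1 :=
  linMap_single _ _

theorem zeroOut_empty : zeroOut k (∅ : Finset (Fin n)) = 𝟙 _ :=
  stdMod_hom_ext k fun j => by rw [zeroOut_single]; simp

theorem zeroOut_zeroOut (U W : Finset (Fin n)) :
    zeroOut k U ≫ zeroOut k W = zeroOut k (U ∪ W) :=
  stdMod_hom_ext k fun j => by
    rw [ModuleCat.hom_comp, LinearMap.comp_apply, zeroOut_single, zeroOut_single]
    by_cases h : j ∈ U
    · simp [h]
    · rw [if_neg h, zeroOut_single]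
      simp [h]

/-- Replaces the faces, which change the dimension, by idempotent endomorphisms of V̄_n. -/
theorem face_coface (i : Fin n) : face k i ≫ coface k i = zeroOut k {i} :=
  stdMod_hom_ext k fun j => by
    rw [ModuleCat.hom_comp, LinearMap.comp_apply, zeroOut_single, face_single]
    split_ifs with h h' h1 h2 h3
    · simp at h'; omega
    · rw [coface_single, if_pos (by simpa using h)]
    · simp at h2; omega
    · have hj : ¬ ((⟨j - 1, by omega⟩ : Fin (n - 1)) : ℕ) < i := by
        simp only; omega
      rw [coface_single, if_neg hj]
      congr 1
      ext; simp only; omega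
    · exact map_zero _
    · simp at h3; omega

theorem zeroOut_face (i : Fin n) : zeroOut k {i} ≫ face k i = face k i :=
  stdMod_hom_ext k fun j => by
    rw [ModuleCat.hom_comp, LinearMap.comp_apply, zeroOut_single]
    split_ifs with h
    · rw [Finset.mem_singleton] at h
      subst h
      rw [map_zero, face_single, dif_neg (lt_irrefl _), dif_neg (lt_irrefl _)]
    · rfl

/-- Adding or removing i pairs the subsets, and the two terms of a pair have opposite signs. -/
theorem alternating_sum_eq_zero {M : Type*} [AddCommGroup M] [Module k M]
    (f : Finset (Fin n) → M) (i : Fin n) (h : ∀ U, f (insert i U) = f U) :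
    ∑ U, (-1 : k) ^ U.card • f U = 0 := by
  refine Finset.sum_involution (fun U _ => if i ∈ U then U.erase i else insert i U) ?_ ?_ ?_ ?_
  · intro U _
    split_ifs with hi
    · have h1 := h (U.erase i)
      rw [Finset.insert_erase hi] at h1
      rw [h1, ← Finset.card_erase_add_one hi, pow_succ]
      simp
    · rw [h, Finset.card_insert_of_notMem hi, pow_succ]
      simp
  · intro U _ _
    split_ifs with hi
    · intro h; rw [← h] at hi; simp at hi
    · intro h; rw [← h] at hi; simp at hi
  · intro U _; exact Finset.mem_univ _
  · intro U _
    by_cases hi : i ∈ U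
    · simp [hi]
    · simp [hi]

variable (B C : ModuleCat.{u} k ⥤ ModuleCat.{u} k)

theorem map_map_apply {U V W : ModuleCat.{u} k} (f : U ⟶ V) (g : V ⟶ W) (x : B.obj U) :
    (B.map g).hom ((B.map f).hom x) = (B.map (f ≫ g)).hom x := by
  rw [B.map_comp]; rfl

variable {B C} in
theorem app_map_apply (η : B ⟶ C) {V W : ModuleCat.{u} k} (f : V ⟶ W) (x : B.obj V) :
    (η.app W).hom ((B.map f).hom x) = (C.map f).hom ((η.app V).hom x) :=
  LinearMap.congr_fun (congrArg ModuleCat.Hom.hom (η.naturality f)) x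

variable (n) in
/-- The projector of `B(V̄_n)` onto `γ_n(B)`. -/
def schurProj : B.obj (stdMod k n) →ₗ[k] B.obj (stdMod k n) :=
  -- The expansion of the product over i of 1 - B(`zeroOut k {i}`), whose factors commute.
  ∑ U : Finset (Fin n), (-1 : k) ^ U.card • (B.map (zeroOut k U)).hom

theorem schurProj_apply (x : B.obj (stdMod k n)) :
    schurProj n B x = ∑ U : Finset (Fin n), (-1 : k) ^ U.card • (B.map (zeroOut k U)).hom x := by
  simp [schurProj]

theorem mem_schurSub_iff (x : B.obj (stdMod k n)) :
    x ∈ (schurSub n B).toSubmodule ↔ ∀ i : Fin n, (B.map (face k i)).hom x = 0 :=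
  Submodule.mem_iInf _

/-- The face d_i factors through `zeroOut k {i}`, so after applying it the terms of U and of U ∪ {i}
agree and cancel. -/
theorem schurProj_mem (x : B.obj (stdMod k n)) :
    schurProj n B x ∈ (schurSub n B).toSubmodule := by
  rw [mem_schurSub_iff]
  intro i
  rw [schurProj_apply, map_sum]
  simp only [map_smul]
  refine alternating_sum_eq_zero _ i fun U => ?_
  rw [map_map_apply, map_map_apply, ← zeroOut_face i, ← Category.assoc, ← Category.assoc,
    zeroOut_zeroOut, zeroOut_zeroOut]
  congr 4
  ext; simp

/-- For i in U the map factors through d_i. Hence on γ_n only the term U = ∅ of the projector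
survives. -/
theorem map_zeroOut_of_mem {x : B.obj (stdMod k n)} (hx : x ∈ (schurSub n B).toSubmodule)
    {U : Finset (Fin n)} {i : Fin n} (hi : i ∈ U) : (B.map (zeroOut k U)).hom x = 0 := by
  have h : zeroOut k U = face k i ≫ (coface k i ≫ zeroOut k U) := by
    rw [← Category.assoc, face_coface, zeroOut_zeroOut, Finset.singleton_union,
      Finset.insert_eq_of_mem hi]
  rw [h, ← map_map_apply, (mem_schurSub_iff B x).1 hx i, map_zero]

theorem schurProj_of_mem {x : B.obj (stdMod k n)} (hx : x ∈ (schurSub n B).toSubmodule) :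
    schurProj n B x = x := by
  rw [schurProj_apply, Finset.sum_eq_single ∅]
  · rw [zeroOut_empty, B.map_id]; simp
  · intro U _ hU
    obtain ⟨i, hi⟩ := Finset.nonempty_iff_ne_empty.2 hU
    rw [map_zeroOut_of_mem B hx hi, smul_zero]
  · simp

/-- Used to discard tensors of basis vectors in which some x_i does not occur. -/
theorem schurProj_map_zeroOut (x : B.obj (stdMod k n)) (i : Fin n) :
    schurProj n B ((B.map (zeroOut k {i})).hom x) = 0 := by
  rw [schurProj_apply]
  refine alternating_sum_eq_zero _ i fun U => ?_
  rw [map_map_apply, map_map_apply, zeroOut_zeroOut, zeroOut_zeroOut]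
  congr 4
  ext; simp

variable {B C} in
theorem app_schurProj (η : B ⟶ C) (x : B.obj (stdMod k n)) :
    (η.app _).hom (schurProj n B x) = schurProj n C ((η.app _).hom x) := by
  rw [schurProj_apply, schurProj_apply, map_sum]
  exact Finset.sum_congr rfl fun U _ => by rw [map_smul, app_map_apply]

end Projector

/-! ### Functoriality and exactness properties of γ_n -/

section SchurMap

variable {k : Type u} [Field k] {n : ℕ} {B C D : ModuleCat.{u} k ⥤ ModuleCat.{u} k}

variable (n B) in
/-- The inclusion of `γ_n(B)` in `B(V̄_n)`. -/
def schurIncl : SchurModule n B →ₗ[k] B.obj (stdMod k n) :=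
  (schurSub n B).toSubmodule.subtype ∘ₗ (schurRep n B).asModuleEquiv.toLinearMap

theorem schurIncl_injective : Function.Injective (schurIncl n B) := fun _ _ h =>
  Subtype.ext h

theorem schurIncl_mem (α : SchurModule n B) : schurIncl n B α ∈ (schurSub n B).toSubmodule :=
  ((schurRep n B).asModuleEquiv α).2

theorem schurIncl_smul (σ : Equiv.Perm (Fin n)) (α : SchurModule n B) :
    schurIncl n B (MonoidAlgebra.single σ (1 : k) • α)
      = (B.map (permMap k σ)).hom (schurIncl n B α) := by
  rw [Representation.single_smul, one_smul]
  rfl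

variable (n B) in
/-- The projector onto `γ_n(B)` with values in the Schur module. -/
def schurRetract : B.obj (stdMod k n) →ₗ[k] SchurModule n B :=
  (schurRep n B).asModuleEquiv.symm.toLinearMap ∘ₗ
    (schurProj n B).codRestrict (schurSub n B).toSubmodule (schurProj_mem B)

theorem schurIncl_schurRetract (x : B.obj (stdMod k n)) :
    schurIncl n B (schurRetract n B x) = schurProj n B x := rfl

theorem schurRetract_schurIncl (α : SchurModule n B) :
    schurRetract n B (schurIncl n B α) = α :=
  schurIncl_injective (by rw [schurIncl_schurRetract, schurProj_of_mem B (schurIncl_mem α)])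

theorem app_mem_schurSub (η : B ⟶ C) {x : B.obj (stdMod k n)}
    (hx : x ∈ (schurSub n B).toSubmodule) : (η.app _).hom x ∈ (schurSub n C).toSubmodule := by
  rw [mem_schurSub_iff] at hx ⊢
  intro i
  rw [← app_map_apply, hx, map_zero]

/-- The map `γ_n(B) → γ_n(C)` induced by a natural transformation. -/
def schurMap (η : B ⟶ C) :
    SchurModule n B →ₗ[MonoidAlgebra k (Equiv.Perm (Fin n))] SchurModule n C :=
  MonoidAlgebra.equivariantOfLinearOfComm
    -- The retraction only restricts the codomain: natural maps already carry γ_n(B) into γ_n(C).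
    (schurRetract n C ∘ₗ (η.app (stdMod k n)).hom ∘ₗ schurIncl n B) fun σ α => by
      refine schurIncl_injective ?_
      simp only [LinearMap.comp_apply]
      rw [schurIncl_schurRetract, schurIncl_smul, schurIncl_smul, schurIncl_schurRetract,
        app_map_apply, schurProj_of_mem C (app_mem_schurSub η (schurIncl_mem α)),
        schurProj_of_mem C]
      exact (schurSub n C).apply_mem_toSubmodule σ (app_mem_schurSub η (schurIncl_mem α))

theorem schurIncl_schurMap (η : B ⟶ C) (α : SchurModule n B) :
    schurIncl n C (schurMap η α) = (η.app _).hom (schurIncl n B α) :=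
  schurProj_of_mem C (app_mem_schurSub η (schurIncl_mem α))

theorem schurMap_id : schurMap (n := n) (𝟙 B) = LinearMap.id :=
  LinearMap.ext fun α => schurIncl_injective (by rw [schurIncl_schurMap]; rfl)

theorem schurMap_comp (η : B ⟶ C) (θ : C ⟶ D) :
    schurMap (n := n) (η ≫ θ) = schurMap θ ∘ₗ schurMap η :=
  LinearMap.ext fun α => schurIncl_injective (by
    rw [schurIncl_schurMap, LinearMap.comp_apply, schurIncl_schurMap, schurIncl_schurMap]; rfl)

theorem schurMap_retract (η : B ⟶ C) (x : B.obj (stdMod k n)) :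
    schurMap η (schurRetract n B x) = schurRetract n C ((η.app _).hom x) :=
  schurIncl_injective (by
    rw [schurIncl_schurMap, schurIncl_schurRetract, schurIncl_schurRetract, app_schurProj])

theorem app_injective (η : B ⟶ C) [Mono η] (V : ModuleCat.{u} k) :
    Function.Injective (η.app V).hom :=
  (ModuleCat.mono_iff_injective _).1 ((NatTrans.mono_iff_mono_app η).1 inferInstance V)

theorem app_surjective (η : B ⟶ C) [Epi η] (V : ModuleCat.{u} k) :
    Function.Surjective (η.app V).hom :=
  (ModuleCat.epi_iff_surjective _).1 ((NatTrans.epi_iff_epi_app η).1 inferInstance V)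

theorem schurMap_injective (η : B ⟶ C) [Mono η] : Function.Injective (schurMap (n := n) η) :=
  fun α β h => schurIncl_injective (app_injective η _ (by
    rw [← schurIncl_schurMap, ← schurIncl_schurMap, h]))

/-- A preimage in B(V̄_n) need not lie in γ_n(B), but its projection does, and naturality of the
projector keeps its image. -/
theorem schurMap_surjective (η : B ⟶ C) [Epi η] : Function.Surjective (schurMap (n := n) η) :=
  fun α => by
    obtain ⟨x, hx⟩ := app_surjective η _ (schurIncl n C α)
    exact ⟨schurRetract n B x, by rw [schurMap_retract, hx, schurRetract_schurIncl]⟩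

end SchurMap

/-! ### γ_n of a free T_n-functor -/

section Free

variable {k : Type u} [Field k] {n : ℕ} {J : Type u}

variable (k n) in
/-- The inclusion of the copy of `V^{⊗ n}` with index `j`. -/
def freeLin (V : ModuleCat.{u} k) (j : J) :
    (⨂[k] _ : Fin n, V) →ₗ[k] (freeTensorPow k n J).obj V :=
  Finsupp.lsingle (M := ⨂[k] _ : Fin n, V) j

variable (k n) in
/-- The projection to the copy of `V^{⊗ n}` with index `j`. -/
def freeCoord (V : ModuleCat.{u} k) (j : J) :
    (freeTensorPow k n J).obj V →ₗ[k] (⨂[k] _ : Fin n, V) :=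
  Finsupp.lapply (M := ⨂[k] _ : Fin n, V) j

theorem freeCoord_freeLin [DecidableEq J] (V : ModuleCat.{u} k) (i j : J)
    (t : ⨂[k] _ : Fin n, V) :
    freeCoord k n V i (freeLin k n V j t) = if j = i then t else 0 := by
  change (Finsupp.single j t : J →₀ ⨂[k] _ : Fin n, V) i = _
  rw [Finsupp.single_apply]

theorem free_ext {V : ModuleCat.{u} k} {x y : (freeTensorPow k n J).obj V}
    (h : ∀ j, freeCoord k n V j x = freeCoord k n V j y) : x = y :=
  Finsupp.ext h

theorem freeTensorPow_map_freeLin {V W : ModuleCat.{u} k} (f : V ⟶ W) (j : J)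
    (t : ⨂[k] _ : Fin n, V) :
    ((freeTensorPow k n J).map f).hom (freeLin k n V j t)
      = freeLin k n W j (PiTensorProduct.map (fun _ => f.hom) t) :=
  Finsupp.mapRange_single (hf := map_zero _)

theorem freeCoord_map {V W : ModuleCat.{u} k} (f : V ⟶ W)
    (z : (freeTensorPow k n J).obj V) (j : J) :
    freeCoord k n W j (((freeTensorPow k n J).map f).hom z)
      = PiTensorProduct.map (fun _ => f.hom) (freeCoord k n V j z) := rfl

variable (k) in
/-- The element `v_1 ⊗ ⋯ ⊗ v_n` of the copy of `V^{⊗ n}` with index `j`. -/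
def freeTensor {V : ModuleCat.{u} k} (j : J) (v : Fin n → V) : (freeTensorPow k n J).obj V :=
  freeLin k n V j (PiTensorProduct.tprod k v)

theorem freeTensorPow_map_freeTensor {V W : ModuleCat.{u} k} (f : V ⟶ W) (j : J)
    (v : Fin n → V) :
    ((freeTensorPow k n J).map f).hom (freeTensor k j v)
      = freeTensor k j fun i => f.hom (v i) := by
  rw [freeTensor, freeTensorPow_map_freeLin, PiTensorProduct.map_tprod]
  rfl

theorem freeTensorPow_lin_ext {V : ModuleCat.{u} k} {M : Type*} [AddCommGroup M] [Module k M]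
    {f g : (freeTensorPow k n J).obj V →ₗ[k] M}
    (h : ∀ j (v : Fin n → V), f (freeTensor k j v) = g (freeTensor k j v)) : f = g :=
  Finsupp.lhom_ext' fun j => PiTensorProduct.ext (MultilinearMap.ext fun v => h j v)

variable (k n) in
/-- The tensor `x_1 ⊗ ⋯ ⊗ x_n` of the copy of `T_n` with index `j`. -/
def stdTensor (j : J) : (freeTensorPow k n J).obj (stdMod k n) :=
  freeTensor k (V := stdMod k n) j fun i : Fin n => (Pi.single i 1 : Fin n → k)

theorem map_linMap_stdTensor {V : ModuleCat.{u} k} (v : Fin n → V) (j : J) :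
    ((freeTensorPow k n J).map (linMap v)).hom (stdTensor k n j) = freeTensor k j v := by
  rw [stdTensor, freeTensorPow_map_freeTensor]
  exact congrArg (freeTensor k j) (funext fun i => linMap_single v i)

theorem map_permMap_stdTensor (σ : Equiv.Perm (Fin n)) (j : J) :
    ((freeTensorPow k n J).map (permMap k σ)).hom (stdTensor k n j)
      = freeTensor k (V := stdMod k n) j fun i => (Pi.single (σ i) 1 : Fin n → k) := by
  rw [stdTensor, freeTensorPow_map_freeTensor]
  exact congrArg (freeTensor k j) (funext fun i => permMap_single k σ i)

theorem stdTensor_mem (j : J) :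
    stdTensor k n j ∈ (schurSub n (freeTensorPow k n J)).toSubmodule := by
  rw [mem_schurSub_iff]
  intro i
  rw [stdTensor, freeTensorPow_map_freeTensor, freeTensor, MultilinearMap.map_coord_zero _ i,
    map_zero]
  rw [face_single, dif_neg (lt_irrefl _), dif_neg (lt_irrefl _)]

variable (k n) in
/-- The generator `x_1 ⊗ ⋯ ⊗ x_n` of the copy of `T_n` with index `j`. -/
def freeGen (j : J) : SchurModule n (freeTensorPow k n J) :=
  schurRetract n (freeTensorPow k n J) (stdTensor k n j)

theorem schurIncl_freeGen (j : J) : schurIncl n _ (freeGen k n j) = stdTensor k n j :=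
  schurProj_of_mem _ (stdTensor_mem j)

/-- A natural transformation from a free functor is determined by the images of generators. -/
theorem freeTensorPow_hom_ext {B : ModuleCat.{u} k ⥤ ModuleCat.{u} k}
    {η θ : freeTensorPow k n J ⟶ B}
    (h : ∀ j, schurMap η (freeGen k n j) = schurMap θ (freeGen k n j)) : η = θ := by
  ext V : 3
  refine freeTensorPow_lin_ext fun j v => ?_
  rw [← map_linMap_stdTensor, app_map_apply, app_map_apply, ← schurIncl_freeGen,
    ← schurIncl_schurMap, ← schurIncl_schurMap, h]

theorem tensor_span_std (t : ⨂[k] _ : Fin n, stdMod k n) :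
    t ∈ Submodule.span k (Set.range fun p : Fin n → Fin n =>
      PiTensorProduct.tprod k fun i => (Pi.single (p i) 1 : stdMod k n)) := by
  have h := (Basis.piTensorProduct fun _ : Fin n => Pi.basisFun k (Fin n)).mem_span t
  have h2 : ⇑(Basis.piTensorProduct fun _ : Fin n => Pi.basisFun k (Fin n)) =
      fun p : Fin n → Fin n =>
        PiTensorProduct.tprod k fun i => (Pi.single (p i) 1 : Fin n → k) := by
    funext p
    rw [Basis.piTensorProduct_apply]
    simp only [Pi.basisFun_apply]
  rwa [h2] at h

/-- A free functor is spanned by pure tensors of basis vectors on the standard module. -/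
theorem freeTensorPow_std_induction {p : (freeTensorPow k n J).obj (stdMod k n) → Prop}
    (hs : ∀ (j : J) (f : Fin n → Fin n),
      p (freeTensor k (V := stdMod k n) j fun i => (Pi.single (f i) 1 : Fin n → k)))
    (h0 : p 0) (hadd : ∀ x y, p x → p y → p (x + y)) (hsmul : ∀ (a : k) x, p x → p (a • x))
    (z : (freeTensorPow k n J).obj (stdMod k n)) : p z := by
  refine Finsupp.induction_linear (motive := p) z h0 hadd fun j t => ?_
  refine Submodule.span_induction (p := fun t _ => p (freeLin k n (stdMod k n) j t))
    ?_ ?_ ?_ ?_ (tensor_span_std t)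
  · rintro _ ⟨f, rfl⟩
    exact hs j f
  · rw [map_zero]; exact h0
  · intro x y _ _ hx hy
    rw [map_add]; exact hadd _ _ hx hy
  · intro a x _ hx
    rw [map_smul]; exact hsmul _ _ hx

/-- `γ_n` of a free functor is spanned by the translates of the generators. -/
theorem schurModule_free_span (α : SchurModule n (freeTensorPow k n J)) :
    α ∈ Submodule.span k (Set.range fun p : J × Equiv.Perm (Fin n) =>
      (MonoidAlgebra.single p.2 (1 : k) • freeGen k n p.1 :
        SchurModule n (freeTensorPow k n J))) := by
  rw [← schurRetract_schurIncl α]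
  refine freeTensorPow_std_induction (p := fun z => schurRetract n (freeTensorPow k n J) z ∈
    Submodule.span k (Set.range fun p : J × Equiv.Perm (Fin n) =>
      (MonoidAlgebra.single p.2 (1 : k) • freeGen k n p.1 :
        SchurModule n (freeTensorPow k n J)))) ?_ ?_ ?_ ?_ (schurIncl n _ α)
  · intro j p
    -- A tensor x_{p(1)} ⊗ ⋯ ⊗ x_{p(n)} with p bijective is a translate of the generator. Otherwise
    -- p misses some i, so `zeroOut k {i}` fixes the tensor and the projector kills it.
    by_cases hp : Function.Bijective p
    · refine Submodule.subset_span ⟨(j, Equiv.ofBijective p hp), schurIncl_injective ?_⟩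
      have h2 := map_permMap_stdTensor (k := k) (Equiv.ofBijective p hp) j
      simp only [Equiv.ofBijective_apply] at h2
      dsimp only
      rw [schurIncl_smul, schurIncl_freeGen, schurIncl_schurRetract, ← h2]
      refine (schurProj_of_mem _ ?_).symm
      exact (schurSub n (freeTensorPow k n J)).apply_mem_toSubmodule
        (Equiv.ofBijective p hp) (stdTensor_mem (k := k) (n := n) j)
    · have hs : ¬ Function.Surjective p := fun h => hp (Finite.surjective_iff_bijective.1 h)
      obtain ⟨i, hi⟩ := not_forall.1 hs
      have h1 := schurProj_map_zeroOut (freeTensorPow k n J) (freeTensor k (V := stdMod k n) j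
        fun i => (Pi.single (p i) 1 : Fin n → k)) i
      have h2 : ∀ l, (zeroOut k {i}).hom (Pi.single (p l) 1) = (Pi.single (p l) 1 : Fin n → k) :=
        fun l => by
          rw [zeroOut_single, if_neg]
          exact fun h => hi ⟨l, Finset.mem_singleton.1 h⟩
      rw [freeTensorPow_map_freeTensor] at h1
      simp only [h2] at h1
      have h0 : schurRetract n (freeTensorPow k n J) (freeTensor k (V := stdMod k n) j
          fun i => (Pi.single (p i) 1 : Fin n → k)) = 0 :=
        schurIncl_injective (by rw [schurIncl_schurRetract, map_zero]; exact h1)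
      rw [h0]
      exact Submodule.zero_mem _
  · rw [map_zero]
    exact Submodule.zero_mem _
  · intro x y hx hy
    rw [map_add]
    exact Submodule.add_mem _ hx hy
  · intro a x hx
    rw [map_smul]
    exact Submodule.smul_mem _ a hx

theorem schurModule_free_hom_ext {M : Type*} [AddCommGroup M]
    [Module (MonoidAlgebra k (Equiv.Perm (Fin n))) M]
    {f g : SchurModule n (freeTensorPow k n J) →ₗ[MonoidAlgebra k (Equiv.Perm (Fin n))] M}
    (h : ∀ j, f (freeGen k n j) = g (freeGen k n j)) : f = g := by
  ext α
  refine Submodule.span_induction (p := fun α _ => f α = g α) ?_ ?_ ?_ ?_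
    (schurModule_free_span α)
  · rintro _ ⟨⟨j, σ⟩, rfl⟩
    dsimp only
    rw [map_smul, map_smul, h]
  · rw [map_zero, map_zero]
  · intro x y _ _ hx hy
    rw [map_add, map_add, hx, hy]
  · intro a x _ hx
    rw [← algebraMap_smul (MonoidAlgebra k (Equiv.Perm (Fin n))) a x, map_smul, map_smul, hx]

variable (k n) in
/-- The coefficient of `x_1 ⊗ ⋯ ⊗ x_n`. -/
def stdCoeff : (⨂[k] _ : Fin n, stdMod k n) →ₗ[k] k :=
  PiTensorProduct.dualDistrib (PiTensorProduct.tprod k fun i : Fin n =>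
    (LinearMap.proj i : (Fin n → k) →ₗ[k] k))

theorem stdCoeff_tprod (v : Fin n → stdMod k n) :
    stdCoeff k n (PiTensorProduct.tprod k v) = ∏ i, (v i : Fin n → k) i := by
  rw [stdCoeff, PiTensorProduct.dualDistrib_apply]; rfl

/-- The coefficient of `x_1 ⊗ ⋯ ⊗ x_n` in the copy of `T_n` with index `j`. -/
def genCoeff (j : J) : (freeTensorPow k n J).obj (stdMod k n) →ₗ[k] k :=
  stdCoeff k n ∘ₗ freeCoord k n (stdMod k n) j

theorem genCoeff_freeTensor [DecidableEq J] (j j' : J) (v : Fin n → stdMod k n) :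
    genCoeff j (freeTensor k j' v) = if j' = j then ∏ i, (v i : Fin n → k) i else 0 := by
  rw [genCoeff, LinearMap.comp_apply, freeTensor, freeCoord_freeLin]
  split_ifs
  · exact stdCoeff_tprod v
  · exact map_zero _

theorem genCoeff_map_zeroOut (j : J) {U : Finset (Fin n)} (hU : U.Nonempty)
    (z : (freeTensorPow k n J).obj (stdMod k n)) :
    genCoeff j (((freeTensorPow k n J).map (zeroOut k U)).hom z) = 0 := by
  classical
  obtain ⟨i, hi⟩ := hU
  have h : (LinearMap.proj i : (Fin n → k) →ₗ[k] k) ∘ₗ (zeroOut k U).hom = 0 := by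
    refine (Pi.basisFun k (Fin n)).ext fun l => ?_
    rw [Pi.basisFun_apply, LinearMap.comp_apply, zeroOut_single]
    split_ifs with hl
    · rfl
    · change (Pi.single l 1 : Fin n → k) i = 0
      rw [Pi.single_eq_of_ne]
      rintro rfl
      exact hl hi
  refine LinearMap.congr_fun (f := genCoeff (k := k) j ∘ₗ
    ((freeTensorPow k n J).map (zeroOut k U)).hom) (g := 0) ?_ z
  refine freeTensorPow_lin_ext fun j' v => ?_
  rw [LinearMap.comp_apply, freeTensorPow_map_freeTensor, genCoeff_freeTensor,
    LinearMap.zero_apply]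
  split_ifs
  · exact Finset.prod_eq_zero (Finset.mem_univ i) (LinearMap.congr_fun h (v i))
  · rfl

/-- The terms with U nonempty contain no multiple of x_1 ⊗ ⋯ ⊗ x_n. So this coefficient of an
arbitrary element can be read off in γ_n. -/
theorem genCoeff_schurProj (j : J) (z : (freeTensorPow k n J).obj (stdMod k n)) :
    genCoeff j (schurProj n _ z) = genCoeff j z := by
  rw [schurProj_apply, map_sum, Finset.sum_eq_single ∅]
  · rw [zeroOut_empty, (freeTensorPow k n J).map_id]; simp
  · intro U _ hU
    rw [map_smul, genCoeff_map_zeroOut j (Finset.nonempty_iff_ne_empty.2 hU), smul_zero]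
  · simp

theorem genCoeff_smul_freeGen [DecidableEq J] (j j' : J) (σ : Equiv.Perm (Fin n)) :
    genCoeff j (schurIncl n _ (MonoidAlgebra.single σ (1 : k) • freeGen k n j'))
      = if j' = j ∧ σ = 1 then 1 else 0 := by
  rw [schurIncl_smul, schurIncl_freeGen, map_permMap_stdTensor, genCoeff_freeTensor]
  by_cases hj : j' = j
  · rw [if_pos hj]
    by_cases hσ : σ = 1
    · subst hσ; simp [hj]
    · rw [if_neg fun h => hσ h.2]
      have : ∃ i, σ i ≠ i := by
        by_contra! h'
        exact hσ (Equiv.ext h')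
      obtain ⟨i, hi⟩ := this
      exact Finset.prod_eq_zero (Finset.mem_univ i) (Pi.single_eq_of_ne hi.symm _)
  · rw [if_neg hj, if_neg fun h => hj h.1]

/-- `γ_n` of a free functor is a projective module. -/
instance projective_schurModule_free :
    Module.Projective (MonoidAlgebra k (Equiv.Perm (Fin n)))
      (SchurModule n (freeTensorPow k n J)) := by
  classical
  let f : (J →₀ MonoidAlgebra k (Equiv.Perm (Fin n)))
      →ₗ[MonoidAlgebra k (Equiv.Perm (Fin n))] SchurModule n (freeTensorPow k n J) :=
    Finsupp.linearCombination _ (freeGen k n)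
  -- The generators are in fact a basis. They generate by `schurModule_free_span`; the coordinates
  -- of x are recovered here by translating by σ⁻¹ and taking the coefficient of the standard
  -- tensor, which gives injectivity.
  have hc : ∀ (σ : Equiv.Perm (Fin n)) (j : J) (x : J →₀ MonoidAlgebra k (Equiv.Perm (Fin n))),
      genCoeff j (schurIncl n _ (MonoidAlgebra.single σ⁻¹ (1 : k) • f x)) = (x j).coeff σ := by
    intro σ j x
    induction x using Finsupp.induction_linear with
    | zero => simp
    | add x y hx hy => rw [map_add, smul_add, map_add, map_add, hx, hy]; rfl
    | single j' a =>
      rw [Finsupp.linearCombination_single, ← mul_smul]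
      rw [← sum_single_coeff a, Finset.mul_sum, Finset.sum_smul, map_sum, map_sum]
      have hτ : ∀ τ : Equiv.Perm (Fin n), genCoeff j (schurIncl n (freeTensorPow k n J)
          ((MonoidAlgebra.single σ⁻¹ (1 : k) * MonoidAlgebra.single τ (a.coeff τ))
            • freeGen k n j')) = if τ = σ then Finsupp.single j' (a.coeff τ) j else 0 := by
        intro τ
        have h1 : MonoidAlgebra.single (σ⁻¹ * τ) (a.coeff τ)
          = a.coeff τ • MonoidAlgebra.single (σ⁻¹ * τ) (1 : k) := by simp
        rw [MonoidAlgebra.single_mul_single, one_mul, h1, smul_assoc, map_smul, map_smul,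
          genCoeff_smul_freeGen, Finsupp.single_apply]
        by_cases h : τ = σ
        · subst h
          simp
        · rw [if_neg fun h' => h (inv_mul_eq_one.1 h'.2).symm, if_neg h, smul_zero]
      rw [Finset.sum_congr rfl fun τ _ => hτ τ, Finset.sum_ite_eq' Finset.univ σ,
        if_pos (Finset.mem_univ _), sum_single_coeff]
      rw [Finsupp.single_apply, Finsupp.single_apply]
      split_ifs <;> rfl
  refine Module.Projective.of_equiv (LinearEquiv.ofBijective f ⟨?_, ?_⟩)
  · rw [← LinearMap.ker_eq_bot, LinearMap.ker_eq_bot']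
    intro x hx
    ext j σ
    rw [← hc, hx, smul_zero, map_zero, map_zero]
    rfl
  · intro α
    refine Submodule.span_induction (p := fun α _ => α ∈ Set.range f) ?_ ?_ ?_ ?_
      (schurModule_free_span α)
    · rintro _ ⟨⟨j, σ⟩, rfl⟩
      exact ⟨Finsupp.single j (MonoidAlgebra.single σ 1), Finsupp.linearCombination_single _ _ _⟩
    · exact ⟨0, map_zero f⟩
    · rintro _ _ _ _ ⟨x, rfl⟩ ⟨y, rfl⟩
      exact ⟨x + y, map_add f x y⟩
    · rintro a _ _ ⟨x, rfl⟩
      exact ⟨a • x, (f.restrictScalars k).map_smul a x⟩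

end Free

/-! ### Functors detected by γ_n -/

section Separated

variable {k : Type u} [Field k]

/-- A functor is separated if its elements are detected by their images in `γ_n`. -/
def IsSeparated (n : ℕ) (B : ModuleCat.{u} k ⥤ ModuleCat.{u} k) : Prop :=
  ∀ (V : ModuleCat.{u} k) (z : B.obj V),
    (∀ φ : V ⟶ stdMod k n, schurRetract n B ((B.map φ).hom z) = 0) → z = 0

variable {n : ℕ} {B C D : ModuleCat.{u} k ⥤ ModuleCat.{u} k}

/-- Quotients do not inherit the property: in characteristic 2 the squares in the symmetric square,
a quotient of T_2, are not detected by γ_2. -/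
theorem IsSeparated.of_mono (h : IsSeparated n C) (i : B ⟶ C) [Mono i] : IsSeparated n B := by
  intro V z hz
  refine app_injective i V ?_
  rw [map_zero]
  refine h V _ fun φ => ?_
  rw [← app_map_apply, ← schurMap_retract, hz, map_zero]

/-- Naturality carries the test of η(z) - θ(z) against φ back to the element of γ_n(B) that z
yields, where the two maps agree. -/
theorem IsSeparated.hom_ext (h : IsSeparated n C) {η θ : B ⟶ C}
    (he : schurMap (n := n) η = schurMap θ) : η = θ := by
  ext V z
  rw [← sub_eq_zero]
  refine h V _ fun φ => ?_
  rw [map_sub, map_sub, ← app_map_apply, ← app_map_apply, ← schurMap_retract, ← schurMap_retract,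
    he, sub_self]

theorem isSeparated_free (J : Type u) : IsSeparated n (freeTensorPow k n J) := by
  intro V z hz
  let b := Module.Free.chooseBasis k V
  refine free_ext fun j => ?_
  refine (Basis.piTensorProduct fun _ : Fin n => b).ext_elem fun p => ?_
  -- With this φ the coordinate of a tensor at b_{p(1)} ⊗ ⋯ ⊗ b_{p(n)} becomes the coefficient of
  -- x_1 ⊗ ⋯ ⊗ x_n of its image.
  let φ : V ⟶ stdMod k n := ModuleCat.ofHom (LinearMap.pi fun i => b.coord (p i))
  have h1 : genCoeff j (((freeTensorPow k n J).map φ).hom z) = 0 := by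
    rw [← genCoeff_schurProj, ← schurIncl_schurRetract, hz φ, map_zero, map_zero]
  have h2 : (Finsupp.lapply p ∘ₗ (Basis.piTensorProduct fun _ : Fin n => b).repr.toLinearMap)
      = stdCoeff k n ∘ₗ PiTensorProduct.map fun _ => φ.hom := by
    refine PiTensorProduct.ext (MultilinearMap.ext fun v => ?_)
    change (Basis.piTensorProduct fun _ : Fin n => b).repr (PiTensorProduct.tprod k v) p
      = stdCoeff k n (PiTensorProduct.map _ (PiTensorProduct.tprod k v))
    rw [Basis.piTensorProduct_repr_tprod_apply, PiTensorProduct.map_tprod, stdCoeff_tprod]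
    rfl
  have h3 := LinearMap.congr_fun h2 (freeCoord k n V j z)
  rw [map_zero, map_zero, Finsupp.zero_apply]
  exact h3.trans h1

end Separated

/-! ### Multilinearity and maps out of free functors -/

section Multilinear

variable {k : Type u} [Field k]

/-- A functor is multilinear on `γ_n` if `B(x_i ↦ v_i)(α)` is multilinear in `v_1, …, v_n` for
all `α` in `γ_n(B)`. -/
def IsMultilinear (n : ℕ) (B : ModuleCat.{u} k ⥤ ModuleCat.{u} k) : Prop :=
  ∀ (α : SchurModule n B) (V : ModuleCat.{u} k), ∃ l : (⨂[k] _ : Fin n, V) →ₗ[k] B.obj V,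
    ∀ v, l (PiTensorProduct.tprod k v) = (B.map (linMap v)).hom (schurIncl n B α)

variable {n : ℕ} {B C : ModuleCat.{u} k ⥤ ModuleCat.{u} k} {J : Type u}

theorem map_linMap_smul (α : SchurModule n B) (σ : Equiv.Perm (Fin n)) {V : ModuleCat.{u} k}
    (v : Fin n → V) :
    (B.map (linMap v)).hom (schurIncl n B (MonoidAlgebra.single σ (1 : k) • α))
      = (B.map (linMap fun i => v (σ i))).hom (schurIncl n B α) := by
  rw [schurIncl_smul, map_map_apply, permMap_linMap]

theorem isMultilinear_free (J : Type u) : IsMultilinear n (freeTensorPow k n J) := by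
  intro α V
  refine Submodule.span_induction (p := fun α _ => ∃ l : (⨂[k] _ : Fin n, V) →ₗ[k]
    (freeTensorPow k n J).obj V, ∀ v, l (PiTensorProduct.tprod k v)
      = ((freeTensorPow k n J).map (linMap v)).hom (schurIncl n _ α)) ?_ ?_ ?_ ?_
    (schurModule_free_span α)
  · rintro _ ⟨⟨j, σ⟩, rfl⟩
    refine ⟨freeLin k n V j ∘ₗ placePerm k n V σ, fun v => ?_⟩
    dsimp only
    rw [map_linMap_smul, schurIncl_freeGen, map_linMap_stdTensor, LinearMap.comp_apply,
      placePerm_tprod]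
    rfl
  · exact ⟨0, fun v => by rw [map_zero, map_zero]; rfl⟩
  · rintro x y _ _ ⟨f, hf⟩ ⟨g, hg⟩
    exact ⟨f + g, fun v => by rw [map_add, map_add, LinearMap.add_apply, hf, hg]⟩
  · rintro a x _ ⟨f, hf⟩
    exact ⟨a • f, fun v => by rw [map_smul, map_smul, LinearMap.smul_apply, hf]⟩

/-- The linear map for C has values in B on pure tensors, hence on their span, which is everything.
-/
theorem IsMultilinear.of_mono (h : IsMultilinear n C) (i : B ⟶ C) [Mono i] :
    IsMultilinear n B := by
  intro α V
  obtain ⟨l, hl⟩ := h (schurMap i α) V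
  have hr : ∀ t, l t ∈ LinearMap.range (i.app V).hom := by
    intro t
    have ht : t ∈ Submodule.span k (Set.range (PiTensorProduct.tprod k)) := by
      rw [PiTensorProduct.span_tprod_eq_top]; trivial
    refine Submodule.span_induction (p := fun t _ => l t ∈ LinearMap.range (i.app V).hom)
      ?_ ?_ ?_ ?_ ht
    · rintro _ ⟨v, rfl⟩
      exact ⟨_, by rw [hl, schurIncl_schurMap, ← app_map_apply]⟩
    · rw [map_zero]; exact Submodule.zero_mem _
    · intro x y _ _ hx hy
      rw [map_add]; exact Submodule.add_mem _ hx hy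
    · intro a x _ hx
      rw [map_smul]; exact Submodule.smul_mem _ a hx
  let e := LinearEquiv.ofInjective (i.app V).hom (app_injective i V)
  refine ⟨e.symm.toLinearMap ∘ₗ l.codRestrict _ hr, fun v => ?_⟩
  refine e.injective (Subtype.ext ?_)
  rw [LinearMap.comp_apply, LinearEquiv.coe_coe, e.apply_symm_apply, LinearMap.codRestrict_apply,
    hl, schurIncl_schurMap]
  exact (app_map_apply i _ _).symm

theorem IsMultilinear.of_epi (h : IsMultilinear n B) (p : B ⟶ C) [Epi p] :
    IsMultilinear n C := by
  intro α V
  obtain ⟨β, rfl⟩ := schurMap_surjective p α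
  obtain ⟨l, hl⟩ := h β V
  exact ⟨(p.app V).hom ∘ₗ l, fun v => by
    rw [LinearMap.comp_apply, hl, app_map_apply, schurIncl_schurMap]⟩

/-- The linear map on `V ↦ ⨁ V^{⊗ n}` with given restrictions to the summands. -/
def freeLift {V : ModuleCat.{u} k} {M : Type*} [AddCommGroup M] [Module k M]
    (f : J → (⨂[k] _ : Fin n, V) →ₗ[k] M) : (freeTensorPow k n J).obj V →ₗ[k] M :=
  Finsupp.lsum k (M := ⨂[k] _ : Fin n, V) f

theorem freeLift_freeTensor {V : ModuleCat.{u} k} {M : Type*} [AddCommGroup M] [Module k M]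
    (f : J → (⨂[k] _ : Fin n, V) →ₗ[k] M) (j : J) (v : Fin n → V) :
    freeLift f (freeTensor k j v) = f j (PiTensorProduct.tprod k v) :=
  Finsupp.lsum_single _ _ _ _

namespace IsMultilinear

variable (h : IsMultilinear n B)

/-- The linear map `V^{⊗ n} → B(V)` that belongs to an element of `γ_n(B)`. -/
def act (α : SchurModule n B) (V : ModuleCat.{u} k) : (⨂[k] _ : Fin n, V) →ₗ[k] B.obj V :=
  (h α V).choose

theorem act_tprod (α : SchurModule n B) {V : ModuleCat.{u} k} (v : Fin n → V) :
    h.act α V (PiTensorProduct.tprod k v) = (B.map (linMap v)).hom (schurIncl n B α) :=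
  (h α V).choose_spec v

theorem map_act (α : SchurModule n B) {V W : ModuleCat.{u} k} (f : V ⟶ W)
    (t : ⨂[k] _ : Fin n, V) : (B.map f).hom (h.act α V t)
      = h.act α W (PiTensorProduct.map (fun _ => f.hom) t) := by
  refine LinearMap.congr_fun (f := (B.map f).hom ∘ₗ h.act α V)
    (g := h.act α W ∘ₗ PiTensorProduct.map (fun _ => f.hom)) ?_ t
  refine PiTensorProduct.ext (MultilinearMap.ext fun v => ?_)
  change (B.map f).hom (h.act α V (PiTensorProduct.tprod k v))
    = h.act α W (PiTensorProduct.map _ (PiTensorProduct.tprod k v))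
  rw [act_tprod, PiTensorProduct.map_tprod, act_tprod, map_map_apply, linMap_comp]

/-- The action `γ_n(B) × V^{⊗ n} → B(V)` as a bilinear map. -/
def actBilin (V : ModuleCat.{u} k) : SchurModule n B →ₗ[k] (⨂[k] _ : Fin n, V) →ₗ[k] B.obj V where
  toFun α := h.act α V
  map_add' α β := PiTensorProduct.ext (MultilinearMap.ext fun v => by
    change h.act (α + β) V (PiTensorProduct.tprod k v)
      = h.act α V (PiTensorProduct.tprod k v) + h.act β V (PiTensorProduct.tprod k v)
    rw [act_tprod, act_tprod, act_tprod, map_add, map_add])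
  map_smul' a α := PiTensorProduct.ext (MultilinearMap.ext fun v => by
    change h.act (a • α) V (PiTensorProduct.tprod k v)
      = a • h.act α V (PiTensorProduct.tprod k v)
    rw [act_tprod, act_tprod, map_smul, map_smul])

theorem act_smul (α : SchurModule n B) (σ : Equiv.Perm (Fin n)) {V : ModuleCat.{u} k}
    (t : ⨂[k] _ : Fin n, V) :
    h.act (MonoidAlgebra.single σ (1 : k) • α) V t = h.act α V (placePerm k n V σ t) := by
  refine LinearMap.congr_fun (f := h.act _ V) (g := h.act α V ∘ₗ placePerm k n V σ) ?_ t
  refine PiTensorProduct.ext (MultilinearMap.ext fun v => ?_)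
  change h.act _ V (PiTensorProduct.tprod k v)
    = h.act α V (placePerm k n V σ (PiTensorProduct.tprod k v))
  rw [act_tprod, placePerm_tprod, act_tprod, map_linMap_smul]

/-- The natural transformation from a free functor with given images of the generators. -/
def freeDesc (α : J → SchurModule n B) : freeTensorPow k n J ⟶ B where
  app V := ModuleCat.ofHom (freeLift fun j => h.act (α j) V)
  naturality V W f := by
    ext : 1
    refine freeTensorPow_lin_ext fun j v => ?_
    change freeLift _ (((freeTensorPow k n J).map f).hom (freeTensor k j v))
      = (B.map f).hom (freeLift _ (freeTensor k j v))
    rw [freeTensorPow_map_freeTensor, freeLift_freeTensor, freeLift_freeTensor, map_act,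
      PiTensorProduct.map_tprod]

theorem freeDesc_app_freeTensor (α : J → SchurModule n B) {V : ModuleCat.{u} k} (j : J)
    (v : Fin n → V) : ((h.freeDesc α).app V).hom (freeTensor k j v)
      = (B.map (linMap v)).hom (schurIncl n B (α j)) :=
  (freeLift_freeTensor _ _ _).trans (h.act_tprod _ _)

theorem schurMap_freeDesc (α : J → SchurModule n B) (j : J) :
    schurMap (h.freeDesc α) (freeGen k n j) = α j := by
  refine schurIncl_injective ?_
  rw [schurIncl_schurMap, schurIncl_freeGen, stdTensor, freeDesc_app_freeTensor]
  have : linMap (V := stdMod k n) (fun i : Fin n => (Pi.single i 1 : Fin n → k)) = 𝟙 _ :=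
    stdMod_hom_ext k fun j => linMap_single _ _
  rw [this, B.map_id]
  rfl

/-- An arbitrary functor admits no map from T_n with a prescribed value on the generator;
multilinearity supplies it. With `freeTensorPow_hom_ext` this identifies maps F → B with module maps
γ_n(F) → γ_n(B). -/
theorem exists_of_schurMap (h : IsMultilinear n B) (f : SchurModule n (freeTensorPow k n J)
      →ₗ[MonoidAlgebra k (Equiv.Perm (Fin n))] SchurModule n B) :
    ∃ r : freeTensorPow k n J ⟶ B, schurMap r = f :=
  ⟨h.freeDesc fun j => f (freeGen k n j), schurModule_free_hom_ext fun j =>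
    h.schurMap_freeDesc _ j⟩

end IsMultilinear

end Multilinear

/-! ### Retracts of free functors -/

section Retract

variable {k : Type u} [Field k] {n : ℕ} {B : ModuleCat.{u} k ⥤ ModuleCat.{u} k} {J : Type u}

theorem IsTnProjective.exists_retract (h : IsTnProjective n B) :
    ∃ (J : Type u) (s : B ⟶ freeTensorPow k n J) (r : freeTensorPow k n J ⟶ B), s ≫ r = 𝟙 B := by
  obtain ⟨J, s, r, hsr⟩ := h
  exact ⟨J, s, r ≫ inv (s ≫ r), by rw [← Category.assoc, IsIso.hom_inv_id]⟩

variable {s : B ⟶ freeTensorPow k n J} {r : freeTensorPow k n J ⟶ B}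

theorem mono_of_retract (h : s ≫ r = 𝟙 B) : Mono s := by
  have : Mono (s ≫ r) := by rw [h]; infer_instance
  exact mono_of_mono s r

theorem isMultilinear_of_retract (h : s ≫ r = 𝟙 B) : IsMultilinear n B :=
  have := mono_of_retract h
  (isMultilinear_free J).of_mono s

theorem isSeparated_of_retract (h : s ≫ r = 𝟙 B) : IsSeparated n B :=
  have := mono_of_retract h
  (isSeparated_free J).of_mono s

theorem schurMap_retract_comp (h : s ≫ r = 𝟙 B) :
    schurMap (n := n) r ∘ₗ schurMap s = LinearMap.id := by
  rw [← schurMap_comp, h, schurMap_id]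

theorem projective_of_retract (h : s ≫ r = 𝟙 B) :
    Module.Projective (MonoidAlgebra k (Equiv.Perm (Fin n))) (SchurModule n B) :=
  Module.Projective.of_split (schurMap s) (schurMap r) (schurMap_retract_comp h)

end Retract

/-! ### The isomorphism of γ_n(B) ⊗ V^{⊗n} with B(V) -/

section SchurTensor

variable {k : Type u} [Field k] {n : ℕ} {B : ModuleCat.{u} k ⥤ ModuleCat.{u} k} {J : Type u}

variable (n B) in
/-- The identity map from the subspace `γ_n(B)` to the Schur module. -/
def toSchurModule : (schurSub n B).toSubmodule ≃ₗ[k] SchurModule n B :=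
  (schurRep n B).asModuleEquiv.symm

theorem toSchurModule_rep (σ : Equiv.Perm (Fin n)) (α : (schurSub n B).toSubmodule) :
    toSchurModule n B (schurRep n B σ α)
      = MonoidAlgebra.single σ (1 : k) • toSchurModule n B α :=
  (schurRep n B).asModuleEquiv_symm_map_rho σ α

/-- The class of `α ⊗ t` in `γ_n(B) ⊗ V^{⊗ n}`. -/
def schurTmul (V : ModuleCat.{u} k) :
    SchurModule n B →ₗ[k] (⨂[k] _ : Fin n, V) →ₗ[k] (schurTensor n B).obj V :=
  ((TensorProduct.mk k (schurSub n B).toSubmodule (⨂[k] _ : Fin n, V)).compr₂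
    (balancedRel n B V).mkQ) ∘ₗ (toSchurModule n B).symm.toLinearMap

theorem schurTmul_smul (V : ModuleCat.{u} k) (σ : Equiv.Perm (Fin n)) (α : SchurModule n B)
    (t : ⨂[k] _ : Fin n, V) : schurTmul V (MonoidAlgebra.single σ (1 : k) • α) t
      = schurTmul V α (placePerm k n V σ t) := by
  obtain ⟨α, rfl⟩ := (toSchurModule n B).surjective α
  rw [← toSchurModule_rep]
  refine (Submodule.Quotient.eq _).2 (Submodule.subset_span ⟨σ, α, t, ?_⟩)
  rfl

theorem schurTensor_ext {V : ModuleCat.{u} k} {M : Type*} [AddCommGroup M] [Module k M]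
    {f g : (schurTensor n B).obj V →ₗ[k] M}
    (h : ∀ α (v : Fin n → V), f (schurTmul V α (PiTensorProduct.tprod k v))
      = g (schurTmul V α (PiTensorProduct.tprod k v))) : f = g := by
  refine Submodule.linearMap_qext _ (TensorProduct.ext (LinearMap.ext fun α => ?_))
  exact PiTensorProduct.ext (MultilinearMap.ext fun v => h (toSchurModule n B α) v)

/-- The natural transformation `γ_n(B) ⊗ V^{⊗ n} → B(V)`. -/
def IsMultilinear.eval (h : IsMultilinear n B) : schurTensor n B ⟶ B where
  app V := ModuleCat.ofHom ((balancedRel n B V).liftQ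
    (TensorProduct.lift (h.actBilin V ∘ₗ (toSchurModule n B).toLinearMap)) (by
      refine Submodule.span_le.2 ?_
      rintro _ ⟨σ, α, t, rfl⟩
      change TensorProduct.lift _ _ = 0
      rw [map_sub, sub_eq_zero]
      change h.act (toSchurModule n B (schurRep n B σ α)) V t
        = h.act (toSchurModule n B α) V (placePerm k n V σ t)
      rw [toSchurModule_rep, h.act_smul]))
  naturality V W f := by
    ext : 1
    refine schurTensor_ext fun α v => ?_
    exact (h.map_act α f _).symm

theorem IsMultilinear.eval_tmul (h : IsMultilinear n B) (V : ModuleCat.{u} k)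
    (α : SchurModule n B) (t : ⨂[k] _ : Fin n, V) :
    (h.eval.app V).hom (schurTmul V α t) = h.act α V t := rfl

theorem nonempty_schurTensor_iso {s : B ⟶ freeTensorPow k n J} {r : freeTensorPow k n J ⟶ B}
    (hsr : s ≫ r = 𝟙 B) : Nonempty (schurTensor n B ≅ B) := by
  have h := isMultilinear_of_retract hsr
  have hrs : ∀ (V : ModuleCat.{u} k) (z : B.obj V), (r.app V).hom ((s.app V).hom z) = z :=
    fun V z => LinearMap.congr_fun (congrArg (fun η : B ⟶ B => (η.app V).hom) hsr) z
  have hiso : ∀ V, IsIso (h.eval.app V) := fun V => by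
    refine (ConcreteCategory.isIso_iff_bijective _).2 ⟨?_, ?_⟩
    -- Ψ sends a tensor t in copy j to r(generator j) ⊗ t. Then Ψ ∘ s is a left inverse of
    -- evaluation, because r ∘ s is the identity on γ_n(B).
    · let Ψ : (freeTensorPow k n J).obj V →ₗ[k] (schurTensor n B).obj V :=
        freeLift fun j => schurTmul V (schurMap r (freeGen k n j))
      have hΨ : ∀ (β : SchurModule n (freeTensorPow k n J)) (v : Fin n → V),
          Ψ (((freeTensorPow k n J).map (linMap v)).hom (schurIncl n _ β))
            = schurTmul V (schurMap r β) (PiTensorProduct.tprod k v) := fun β v => by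
        refine Submodule.span_induction (p := fun β _ =>
          Ψ (((freeTensorPow k n J).map (linMap v)).hom (schurIncl n _ β))
            = schurTmul V (schurMap r β) (PiTensorProduct.tprod k v)) ?_ ?_ ?_ ?_
          (schurModule_free_span β)
        · rintro _ ⟨⟨j, σ⟩, rfl⟩
          dsimp only
          rw [map_linMap_smul, schurIncl_freeGen, map_linMap_stdTensor, map_smul, schurTmul_smul,
            placePerm_tprod]
          exact freeLift_freeTensor _ _ _
        · simp only [map_zero, LinearMap.zero_apply]
        · intro x y _ _ hx hy
          simp only [map_add, LinearMap.add_apply, hx, hy]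
        · intro a x _ hx
          have h1 : schurMap r (a • x) = a • schurMap r x :=
            ((schurMap r).restrictScalars k).map_smul a x
          rw [h1, map_smul, map_smul, map_smul, map_smul, LinearMap.smul_apply, hx]
      have hid : Ψ ∘ₗ (s.app V).hom ∘ₗ (h.eval.app V).hom = LinearMap.id := by
        refine schurTensor_ext fun α v => ?_
        rw [LinearMap.comp_apply, LinearMap.comp_apply, h.eval_tmul, h.act_tprod, app_map_apply,
          ← schurIncl_schurMap, hΨ]
        have := LinearMap.congr_fun (schurMap_retract_comp hsr) α
        rw [LinearMap.comp_apply] at this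
        rw [this]
        rfl
      intro x y hxy
      have h1 := LinearMap.congr_fun hid x
      have h2 := LinearMap.congr_fun hid y
      have h3 : (h.eval.app V).hom x = (h.eval.app V).hom y := hxy
      rw [LinearMap.comp_apply, LinearMap.comp_apply, h3] at h1
      exact h1.symm.trans h2
    -- The transformation r factors through evaluation, and r is onto since s is a section of it.
    · have hr : LinearMap.range (r.app V).hom ≤ LinearMap.range (h.eval.app V).hom := by
        let Θ : (freeTensorPow k n J).obj V →ₗ[k] (schurTensor n B).obj V :=
          freeLift fun j => schurTmul V (schurMap r (freeGen k n j))
        have hΘ : (h.eval.app V).hom ∘ₗ Θ = (r.app V).hom := by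
          refine freeTensorPow_lin_ext fun j v => ?_
          have h1 : Θ (freeTensor k j v)
              = schurTmul V (schurMap r (freeGen k n j)) (PiTensorProduct.tprod k v) :=
            freeLift_freeTensor _ _ _
          rw [LinearMap.comp_apply, h1, h.eval_tmul, h.act_tprod, schurIncl_schurMap,
            ← app_map_apply, schurIncl_freeGen, map_linMap_stdTensor]
        rw [← hΘ]
        exact LinearMap.range_comp_le_range _ _
      intro z
      exact hr ⟨(s.app V).hom z, hrs V z⟩
  have : IsIso h.eval := NatIso.isIso_of_isIso_app _
  exact ⟨asIso h.eval⟩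

end SchurTensor

/-! ### Splitting subfunctors and quotients of free functors -/

section FiniteRank

variable {k : Type u} [Field k] {n : ℕ} {B C : ModuleCat.{u} k ⥤ ModuleCat.{u} k} {J : Type u}

instance finite_freeTensorPow_obj [Finite J] (V : ModuleCat.{u} k) [Module.Finite k V] :
    Module.Finite k ((freeTensorPow k n J).obj V) :=
  inferInstanceAs (Module.Finite k (J →₀ ⨂[k] _ : Fin n, V))

instance finite_schurModule_free [Finite J] :
    Module.Finite k (SchurModule n (freeTensorPow k n J)) :=
  have : Module.Finite k (stdMod k n) := inferInstanceAs (Module.Finite k (Fin n → k))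
  Module.Finite.of_injective (schurIncl n _) schurIncl_injective

theorem finite_schurModule_of_mono (i : B ⟶ C) [Mono i] [Module.Finite k (SchurModule n C)] :
    Module.Finite k (SchurModule n B) :=
  Module.Finite.of_injective ((schurMap i).restrictScalars k) (schurMap_injective i)

theorem finite_schurModule_of_epi (p : B ⟶ C) [Epi p] [Module.Finite k (SchurModule n B)] :
    Module.Finite k (SchurModule n C) :=
  Module.Finite.of_surjective ((schurMap p).restrictScalars k) (schurMap_surjective p)

/-- A subfunctor of a free functor of finite rank with projective Schur module is a retract. -/
theorem exists_retraction_of_mono [Finite J] (i : B ⟶ freeTensorPow k n J) [Mono i]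
    [Module.Projective (MonoidAlgebra k (Equiv.Perm (Fin n))) (SchurModule n B)] :
    ∃ r : freeTensorPow k n J ⟶ B, i ≫ r = 𝟙 B := by
  have := finite_schurModule_of_mono (n := n) i
  -- Self-injectivity of the group algebra splits γ_n(B) off γ_n(F). B is multilinear and separated
  -- as a subfunctor, so the splitting lifts to a natural retraction.
  obtain ⟨ρ, hρ⟩ := exists_extension_of_projective (schurMap i) (schurMap_injective i)
    (LinearMap.id : SchurModule n B →ₗ[MonoidAlgebra k (Equiv.Perm (Fin n))] SchurModule n B)
  obtain ⟨r, hr⟩ := ((isMultilinear_free J).of_mono i).exists_of_schurMap ρ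
  refine ⟨r, ((isSeparated_free J).of_mono i).hom_ext ?_⟩
  rw [schurMap_comp, hr, hρ, schurMap_id]

/-- A natural transformation out of the source of an epimorphism `p` to a separated functor
factors through `p` if its restriction to the Schur modules does. -/
theorem exists_factor_of_epi (hC : IsSeparated n C) {D : ModuleCat.{u} k ⥤ ModuleCat.{u} k}
    (p : D ⟶ B) [Epi p] (e : D ⟶ C)
    (f : SchurModule n B →ₗ[MonoidAlgebra k (Equiv.Perm (Fin n))] SchurModule n C)
    (he : schurMap e = f ∘ₗ schurMap p) : ∃ s : B ⟶ C, p ≫ s = e := by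
  -- On γ_n the restriction of e to the kernel of p factors through zero, and C is separated.
  have h0 : Limits.kernel.ι p ≫ e = 0 := by
    refine hC.hom_ext ?_
    rw [schurMap_comp, he, LinearMap.comp_assoc, ← schurMap_comp, Limits.kernel.condition]
    refine LinearMap.ext fun α => schurIncl_injective ?_
    have h1 : ∀ (E E' : ModuleCat.{u} k ⥤ ModuleCat.{u} k) (α : SchurModule n E),
        schurMap (0 : E ⟶ E') α = 0 := fun E E' α => schurIncl_injective (by
      rw [schurIncl_schurMap, map_zero]; rfl)
    rw [LinearMap.comp_apply, h1, h1, map_zero]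
  exact ⟨Abelian.epiDesc p e h0, Abelian.comp_epiDesc p e h0⟩

/-- A quotient of a free functor with projective Schur module is a retract. -/
theorem exists_section_of_epi (p : freeTensorPow k n J ⟶ B) [Epi p]
    [Module.Projective (MonoidAlgebra k (Equiv.Perm (Fin n))) (SchurModule n B)] :
    ∃ s : B ⟶ freeTensorPow k n J, s ≫ p = 𝟙 B := by
  obtain ⟨f, hf⟩ := Module.projective_lifting_property (schurMap (n := n) p) LinearMap.id
    (schurMap_surjective p)
  -- A module map out of γ_n(B) is not directly realisable, since B is not free. Its composite with
  -- γ_n(p) is realised on the free functor and then descends along p.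
  obtain ⟨e, he⟩ := (isMultilinear_free J).exists_of_schurMap (f ∘ₗ schurMap p)
  obtain ⟨s, hs⟩ := exists_factor_of_epi (isSeparated_free J) p e f he
  refine ⟨s, ?_⟩
  rw [← cancel_epi p, ← Category.assoc, hs, Category.comp_id]
  refine freeTensorPow_hom_ext fun j => ?_
  rw [schurMap_comp, he, ← LinearMap.comp_assoc, hf, LinearMap.id_comp]

theorem isTnProjective_of_retract {s : B ⟶ freeTensorPow k n J} {r : freeTensorPow k n J ⟶ B}
    (h : s ≫ r = 𝟙 B) : IsTnProjective n B :=
  ⟨J, s, r, by rw [h]; infer_instance⟩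

end FiniteRank

/-! ### Projectivity and injectivity among subquotients -/

section Subquotient

variable {k : Type u} [Field k] {n : ℕ} {B C : ModuleCat.{u} k ⥤ ModuleCat.{u} k}

theorem IsSubfunctor.of_mono (h : IsSubfunctor n C) (i : B ⟶ C) [Mono i] : IsSubfunctor n B := by
  obtain ⟨J, hJ, j, hj⟩ := h
  exact ⟨J, hJ, i ≫ j, mono_comp i j⟩

theorem IsSubquotient.of_epi (h : IsSubquotient n B) (p : B ⟶ C) [Epi p] :
    IsSubquotient n C := by
  obtain ⟨D, q, hD, hq⟩ := h
  exact ⟨D, q ≫ p, hD, epi_comp q p⟩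

/-- The preimage of B in D is a subfunctor of D and maps onto B. -/
theorem IsSubquotient.of_mono (h : IsSubquotient n C) (i : B ⟶ C) [Mono i] :
    IsSubquotient n B := by
  obtain ⟨D, q, hD, hq⟩ := h
  exact ⟨Limits.pullback q i, Limits.pullback.snd q i, hD.of_mono (Limits.pullback.fst q i),
    inferInstance⟩

theorem IsSubquotient.isMultilinear (h : IsSubquotient n B) : IsMultilinear n B := by
  obtain ⟨D, q, ⟨J, hJ, j, hj⟩, hq⟩ := h
  exact ((isMultilinear_free J).of_mono j).of_epi q

theorem IsSubquotient.finite_schurModule (h : IsSubquotient n B) :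
    Module.Finite k (SchurModule n B) := by
  obtain ⟨D, q, ⟨J, hJ, j, hj⟩, hq⟩ := h
  have := finite_schurModule_of_mono (n := n) j
  exact finite_schurModule_of_epi q

/-- Subquotients are closed under quotients, so the cokernel lies in the subcategory and
cancellation against e makes it zero. -/
theorem epi_hom_of_epi {X Y : (IsSubquotient (k := k) n).FullSubcategory} (e : X ⟶ Y) [Epi e] :
    Epi e.hom := by
  refine Preadditive.epi_of_cokernel_zero ?_
  let Q : (IsSubquotient (k := k) n).FullSubcategory :=
    ⟨Limits.cokernel e.hom, Y.property.of_epi (Limits.cokernel.π e.hom)⟩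
  let π : Y ⟶ Q := ObjectProperty.homMk (Limits.cokernel.π e.hom)
  let z : Y ⟶ Q := ObjectProperty.homMk 0
  have h : e ≫ π = e ≫ z := by
    ext : 1
    change e.hom ≫ Limits.cokernel.π e.hom = e.hom ≫ 0
    rw [Limits.cokernel.condition, Limits.comp_zero]
  exact congrArg (fun f => f.hom) ((cancel_epi e).1 h)

theorem mono_hom_of_mono {X Y : (IsSubquotient (k := k) n).FullSubcategory} (e : X ⟶ Y)
    [Mono e] : Mono e.hom := by
  refine Preadditive.mono_of_kernel_zero ?_
  let K : (IsSubquotient (k := k) n).FullSubcategory :=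
    ⟨Limits.kernel e.hom, X.property.of_mono (Limits.kernel.ι e.hom)⟩
  let ι : K ⟶ X := ObjectProperty.homMk (Limits.kernel.ι e.hom)
  let z : K ⟶ X := ObjectProperty.homMk 0
  have h : ι ≫ e = z ≫ e := by
    ext : 1
    change Limits.kernel.ι e.hom ≫ e.hom = 0 ≫ e.hom
    rw [Limits.kernel.condition, Limits.zero_comp]
  exact congrArg (fun f => f.hom) ((cancel_mono e).1 h)

/-- The images of the generators lift along the surjection on γ_n. Multilinearity of E turns the
lifts into a map from the free functor, and s restricts that map to B. -/
theorem projective_of_isTnProjective (hB : IsSubquotient n B) (h : IsTnProjective n B) :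
    Projective (⟨B, hB⟩ : (IsSubquotient (k := k) n).FullSubcategory) where
  factors {E X} f e he := by
    obtain ⟨J, s, r, hsr⟩ := h.exists_retract
    have := epi_hom_of_epi e
    obtain ⟨β, hβ⟩ : ∃ β : J → SchurModule n E.obj,
        ∀ j, schurMap e.hom (β j) = schurMap (r ≫ f.hom) (freeGen k n j) :=
      ⟨fun j => (schurMap_surjective e.hom _).choose,
        fun j => (schurMap_surjective e.hom _).choose_spec⟩
    let g := E.property.isMultilinear.freeDesc β
    have hg : g ≫ e.hom = r ≫ f.hom := freeTensorPow_hom_ext fun j => by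
      rw [schurMap_comp, LinearMap.comp_apply, IsMultilinear.schurMap_freeDesc, hβ]
    refine ⟨ObjectProperty.homMk (s ≫ g), ?_⟩
    ext : 1
    change (s ≫ g) ≫ e.hom = f.hom
    rw [Category.assoc, hg, ← Category.assoc, hsr, Category.id_comp]

/-- Y is a quotient of a subfunctor D of a free functor. The map f is pulled back to the preimage of
X in D, extended to the free functor by self-injectivity, and restricted to D; it then descends to
Y. -/
theorem injective_of_isTnProjective (hB : IsSubquotient n B) (h : IsTnProjective n B) :
    Injective (⟨B, hB⟩ : (IsSubquotient (k := k) n).FullSubcategory) where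
  factors {X Y} f g hg := by
    obtain ⟨J₀, s, r, hsr⟩ := h.exists_retract
    have := mono_hom_of_mono g
    -- The free functor of which B is a retract may have infinite rank; finiteness of γ_n(B) comes
    -- from B being a subquotient.
    have := hB.finite_schurModule
    have := projective_of_retract hsr
    have hsep := isSeparated_of_retract hsr
    obtain ⟨D, p, ⟨J, hJ, i, hi⟩, hp⟩ := Y.property
    let a := Limits.pullback.fst p g.hom
    let b := Limits.pullback.snd p g.hom
    have hab : a ≫ p = b ≫ g.hom := Limits.pullback.condition
    have hai : Mono (a ≫ i) := mono_comp a i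
    obtain ⟨ρ, hρ⟩ := exists_extension_of_projective (schurMap (a ≫ i))
      (schurMap_injective (a ≫ i)) (schurMap (n := n) (b ≫ f.hom))
    obtain ⟨e, he⟩ := hB.isMultilinear.exists_of_schurMap ρ
    have hext : a ≫ i ≫ e = b ≫ f.hom := hsep.hom_ext (by
      rw [← Category.assoc, schurMap_comp, he, hρ])
    -- The kernel of p lies in the preimage of X, where the extension agrees with f and hence
    -- vanishes.
    have h0 : Limits.kernel.ι p ≫ i ≫ e = 0 := by
      let κ := Limits.pullback.lift (f := p) (g := g.hom) (Limits.kernel.ι p) 0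
        (by rw [Limits.kernel.condition, Limits.zero_comp])
      have h1 : κ ≫ a = Limits.kernel.ι p := Limits.pullback.lift_fst _ _ _
      have h2 : κ ≫ b = 0 := Limits.pullback.lift_snd _ _ _
      rw [← h1, Category.assoc, hext, ← Category.assoc, h2, Limits.zero_comp]
    let d := Abelian.epiDesc p (i ≫ e) h0
    have hd : p ≫ d = i ≫ e := Abelian.comp_epiDesc p (i ≫ e) h0
    refine ⟨ObjectProperty.homMk d, ?_⟩
    ext : 1
    change g.hom ≫ d = f.hom
    have hb : Epi b := inferInstanceAs (Epi (Limits.pullback.snd p g.hom))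
    rw [← cancel_epi b, ← Category.assoc, ← hab, Category.assoc, hd, hext]

end Subquotient

/-! ### The dual functor on objects and transformations -/

section DualObj

variable {k : Type u} [Field k] {B C : ModuleCat.{u} k ⥤ ModuleCat.{u} k}

instance isDirectedOrder_finSub (V : ModuleCat.{u} k) : IsDirectedOrder (FinSub V) where
  directed S T :=
    have := S.2
    have := T.2
    ⟨⟨S.1 ⊔ T.1, inferInstance⟩, (le_sup_left : S.1 ≤ S.1 ⊔ T.1),
      (le_sup_right : T.1 ≤ S.1 ⊔ T.1)⟩

open Classical in
/-- The universal property of `B^*(V)`. -/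
def dualLift {V : ModuleCat.{u} k} {P : Type u} [AddCommGroup P] [Module k P]
    (g : ∀ S : FinSub V, DualAt B S.1 →ₗ[k] P)
    (hg : ∀ (S T : FinSub V) (h : S.1 ≤ T.1) x,
      g T (dualAtMap B (Submodule.inclusion h) x) = g S x) : DualObj B V →ₗ[k] P :=
  Module.DirectLimit.lift k (FinSub V) (fun S : FinSub V => DualAt B S.1) (dualSystem B V) g hg

theorem dualLift_of {V : ModuleCat.{u} k} {P : Type u} [AddCommGroup P] [Module k P]
    (g : ∀ S : FinSub V, DualAt B S.1 →ₗ[k] P)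
    (hg : ∀ (S T : FinSub V) (h : S.1 ≤ T.1) x,
      g T (dualAtMap B (Submodule.inclusion h) x) = g S x) (S : FinSub V) (x : DualAt B S.1) :
    dualLift g hg (dualOf B V S x) = g S x := by
  classical
  exact Module.DirectLimit.lift_of (R := k) (ι := FinSub V) (f := dualSystem B V) _ _ x

theorem dualLift_injective {V : ModuleCat.{u} k} {P : Type u} [AddCommGroup P] [Module k P]
    (g : ∀ S : FinSub V, DualAt B S.1 →ₗ[k] P)
    (hg : ∀ (S T : FinSub V) (h : S.1 ≤ T.1) x,
      g T (dualAtMap B (Submodule.inclusion h) x) = g S x)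
    (hi : ∀ S, Function.Injective (g S)) : Function.Injective (dualLift g hg) := by
  classical
  exact Module.DirectLimit.lift_injective (R := k) (ι := FinSub V) (f := dualSystem B V) g hg hi

theorem exists_dualOf {V : ModuleCat.{u} k} (z : DualObj B V) : ∃ S x, dualOf B V S x = z := by
  classical
  have : Nonempty (FinSub V) := ⟨⟨⊥, inferInstance⟩⟩
  exact Module.DirectLimit.exists_of (R := k) (ι := FinSub V) (f := dualSystem B V) z

variable (B) in
/-- The comparison of `B^*(V)` with `B(V*)*`. -/
def dualObjToDualAt (V : ModuleCat.{u} k) : DualObj B V →ₗ[k] DualAt B V :=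
  dualLift (P := DualAt B V) (fun S => dualAtMap B S.1.subtype) fun S T h x => by
    rw [← dualAtMap_comp, Submodule.subtype_comp_inclusion]

theorem dualObjToDualAt_of (V : ModuleCat.{u} k) (S : FinSub V) (x : DualAt B S.1) :
    dualObjToDualAt B V (dualOf B V S x) = dualAtMap B S.1.subtype x :=
  dualLift_of _ _ S x

/-- V itself is the largest index of the direct system. -/
theorem dualObjToDualAt_bijective (V : ModuleCat.{u} k) [Module.Finite k V] :
    Function.Bijective (dualObjToDualAt B V) := by
  refine Function.bijective_iff_has_inverse.2 ⟨fun x => dualOf B V ⟨⊤, inferInstance⟩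
    (dualAtMap B (Submodule.topEquiv (R := k) (M := V)).symm.toLinearMap x), fun z => ?_,
    fun x => ?_⟩
  · obtain ⟨S, x, rfl⟩ := exists_dualOf z
    beta_reduce
    rw [dualObjToDualAt_of, ← dualAtMap_comp]
    have h : S ≤ (⟨⊤, inferInstance⟩ : FinSub V) := (le_top : S.1 ≤ ⊤)
    exact dualOf_system B V h x
  · rw [dualObjToDualAt_of, ← dualAtMap_comp]
    have : (⊤ : Submodule k V).subtype ∘ₗ
      (Submodule.topEquiv (R := k) (M := V)).symm.toLinearMap = LinearMap.id := rfl
    rw [this, dualAtMap_id, LinearMap.id_apply]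

variable (B) in
/-- On a finite-dimensional module, `B^*(V)` is `B(V*)*`. -/
def dualObjEquiv (V : ModuleCat.{u} k) [Module.Finite k V] : DualObj B V ≃ₗ[k] DualAt B V :=
  LinearEquiv.ofBijective (dualObjToDualAt B V) (dualObjToDualAt_bijective V)

theorem dualObjEquiv_map {V W : ModuleCat.{u} k} [Module.Finite k V] [Module.Finite k W]
    (f : V ⟶ W) (x : DualObj B V) :
    dualObjEquiv B W (dualObjMap B f x) = dualAtMap B f.hom (dualObjEquiv B V x) := by
  obtain ⟨S, x, rfl⟩ := exists_dualOf x
  change dualObjToDualAt B W _ = dualAtMap B f.hom (dualObjToDualAt B V _)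
  rw [dualObjMap_of, dualObjToDualAt_of, dualObjToDualAt_of, ← dualAtMap_comp, ← dualAtMap_comp]
  rfl

/-- The map `C^*(V) → B^*(V)` induced by `B ⟶ C`. -/
def dualObjTrans (η : B ⟶ C) (V : ModuleCat.{u} k) : DualObj C V →ₗ[k] DualObj B V :=
  dualLift (P := DualObj B V)
    (fun S => dualOf B V S ∘ₗ (η.app (ModuleCat.of k (Module.Dual k S.1))).hom.dualMap)
    fun S T h x => by
      rw [LinearMap.comp_apply, LinearMap.comp_apply, ← dualOf_system B V (S := S) (T := T) h]
      refine congrArg _ (LinearMap.ext fun y => ?_)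
      exact congrArg x (app_map_apply η _ y).symm

theorem dualObjTrans_of (η : B ⟶ C) (V : ModuleCat.{u} k) (S : FinSub V) (x : DualAt C S.1) :
    dualObjTrans η V (dualOf C V S x)
      = dualOf B V S ((η.app (ModuleCat.of k (Module.Dual k S.1))).hom.dualMap x) :=
  dualLift_of _ _ S x

theorem dualObjTrans_naturality (η : B ⟶ C) {V W : ModuleCat.{u} k} (f : V ⟶ W)
    (x : DualObj C V) :
    dualObjTrans η W (dualObjMap C f x) = dualObjMap B f (dualObjTrans η V x) := by
  obtain ⟨S, x, rfl⟩ := exists_dualOf x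
  rw [dualObjMap_of, dualObjTrans_of, dualObjTrans_of, dualObjMap_of]
  refine congrArg _ (LinearMap.ext fun y => ?_)
  exact congrArg x (app_map_apply η _ y).symm

/-- The natural transformation `C^* ⟶ B^*` induced by `B ⟶ C`. -/
def dualNatTrans (η : B ⟶ C) : dualFunctor C ⟶ dualFunctor B where
  app V := ModuleCat.ofHom (dualObjTrans η V)
  naturality V W f := by
    ext : 1
    exact LinearMap.ext fun x => dualObjTrans_naturality η f x

theorem dualNatTrans_retract {s : B ⟶ C} {r : C ⟶ B} (h : s ≫ r = 𝟙 B) :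
    dualNatTrans r ≫ dualNatTrans s = 𝟙 (dualFunctor B) := by
  ext V : 3
  refine LinearMap.ext fun x => ?_
  obtain ⟨S, x, rfl⟩ := exists_dualOf x
  change dualObjTrans s V (dualObjTrans r V (dualOf B V S x)) = dualOf B V S x
  rw [dualObjTrans_of, dualObjTrans_of]
  refine congrArg _ (LinearMap.ext fun y => congrArg x ?_)
  exact LinearMap.congr_fun (congrArg (fun η : B ⟶ B => (η.app _).hom) h) y

end DualObj

/-! ### γ_n of the dual functor is the contragredient of γ_n -/

section DualSchur

variable {k : Type u} [Field k] {n : ℕ} (B : ModuleCat.{u} k ⥤ ModuleCat.{u} k)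

/-- This description suits duality: each `zeroOut k {i}` is an endomorphism equal to its own
transpose. -/
theorem mem_schurSub_iff_zeroOut (x : B.obj (stdMod k n)) :
    x ∈ (schurSub n B).toSubmodule ↔ ∀ i : Fin n, (B.map (zeroOut k {i})).hom x = 0 := by
  refine ⟨fun h i => map_zeroOut_of_mem B h (Finset.mem_singleton_self i), fun h => ?_⟩
  rw [mem_schurSub_iff]
  intro i
  rw [← zeroOut_face, ← map_map_apply, h, map_zero]

instance finite_stdMod : Module.Finite k (stdMod k n) :=
  inferInstanceAs (Module.Finite k (Fin n → k))

variable (k n) in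
/-- The isomorphism of the standard module with its dual. -/
def stdDual : stdMod k n ≅ ModuleCat.of k (Module.Dual k (Fin n → k)) :=
  (dotProductEquiv k (Fin n)).toModuleIso

/-- The hypothesis says that the matrices of f and g in the standard basis are transposes of each
other. -/
theorem stdDual_transpose {f g : stdMod k n ⟶ stdMod k n}
    (h : ∀ j l, (f.hom (Pi.single j 1) : Fin n → k) l = (g.hom (Pi.single l 1) : Fin n → k) j) :
    (stdDual k n).hom ≫ ModuleCat.ofHom f.hom.dualMap = g ≫ (stdDual k n).hom := by
  refine stdMod_hom_ext k fun l => ?_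
  refine (Pi.basisFun k (Fin n)).ext fun j => ?_
  rw [Pi.basisFun_apply]
  change (Pi.single l 1 : Fin n → k) ⬝ᵥ (f.hom (Pi.single j 1) : Fin n → k)
    = (g.hom (Pi.single l 1) : Fin n → k) ⬝ᵥ (Pi.single j 1 : Fin n → k)
  rw [single_one_dotProduct, dotProduct_single_one, h]

theorem zeroOut_symm (U : Finset (Fin n)) (j l : Fin n) :
    ((zeroOut k U).hom (Pi.single j 1) : Fin n → k) l
      = ((zeroOut k U).hom (Pi.single l 1) : Fin n → k) j := by
  rw [zeroOut_single, zeroOut_single]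
  by_cases h : j = l
  · rw [h]
  · split_ifs <;> simp [h, Ne.symm h]

theorem permMap_transpose (σ : Equiv.Perm (Fin n)) (j l : Fin n) :
    ((permMap k σ).hom (Pi.single j 1) : Fin n → k) l
      = ((permMap k σ⁻¹).hom (Pi.single l 1) : Fin n → k) j := by
  rw [permMap_single, permMap_single, Pi.single_apply, Pi.single_apply]
  congr 1
  rw [Equiv.Perm.eq_inv_iff_eq]
  exact propext eq_comm

variable (n) in
/-- The identification of `B^*(V̄_n)` with the dual of `B(V̄_n)`. -/
def dualStdEquiv : (dualFunctor B).obj (stdMod k n) ≃ₗ[k] Module.Dual k (B.obj (stdMod k n)) :=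
  (dualObjEquiv B (stdMod k n)).trans
    (B.mapIso (stdDual k n)).toLinearEquiv.dualMap

theorem dualStdEquiv_map {f g : stdMod k n ⟶ stdMod k n}
    (h : ∀ j l, (f.hom (Pi.single j 1) : Fin n → k) l = (g.hom (Pi.single l 1) : Fin n → k) j)
    (x : (dualFunctor B).obj (stdMod k n)) (y : B.obj (stdMod k n)) :
    dualStdEquiv n B (((dualFunctor B).map f).hom x) y
      = dualStdEquiv n B x ((B.map g).hom y) := by
  change dualObjEquiv B (stdMod k n) (dualObjMap B f x) ((B.map (stdDual k n).hom).hom y)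
    = dualObjEquiv B (stdMod k n) x ((B.map (stdDual k n).hom).hom ((B.map g).hom y))
  refine (LinearMap.congr_fun (dualObjEquiv_map f x) _).trans ?_
  rw [map_map_apply, ← stdDual_transpose h, ← map_map_apply]
  rfl

/-- The pairing of `γ_n(B^*)` with `γ_n(B)`. -/
def dualSchurLin : SchurModule n (dualFunctor B) →ₗ[k] Module.Dual k (SchurModule n B) :=
  (schurIncl n B).dualMap ∘ₗ (dualStdEquiv n B).toLinearMap ∘ₗ schurIncl n (dualFunctor B)

theorem dualSchurLin_apply (x : SchurModule n (dualFunctor B)) (y : SchurModule n B) :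
    dualSchurLin B x y = dualStdEquiv n B (schurIncl n _ x) (schurIncl n B y) := rfl

/-- The maps `zeroOut` are self-transpose, so the projectors for B^* and B are adjoint under the
perfect pairing on V̄_n, and the pairing of their images is perfect. -/
theorem dualSchurLin_bijective : Function.Bijective (dualSchurLin (n := n) B) := by
  constructor
  · rw [← LinearMap.ker_eq_bot, LinearMap.ker_eq_bot']
    intro x hx
    refine schurIncl_injective ((dualStdEquiv n B).injective ?_)
    rw [map_zero, map_zero]
    ext y
    have h1 : dualStdEquiv n B (schurIncl n _ x) (schurProj n B y) = 0 :=
      LinearMap.congr_fun hx (schurRetract n B y)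
    rw [schurProj_apply, map_sum, Finset.sum_eq_single ∅] at h1
    · rw [zeroOut_empty, B.map_id] at h1
      simpa using h1
    · intro U _ hU
      obtain ⟨i, hi⟩ := Finset.nonempty_iff_ne_empty.2 hU
      rw [map_smul, ← dualStdEquiv_map B (zeroOut_symm U),
        map_zeroOut_of_mem _ (schurIncl_mem x) hi, map_zero, LinearMap.zero_apply, smul_zero]
    · simp
  · intro φ
    -- The functional φ is extended by zero on the kernel of the projector.
    let x := (dualStdEquiv n B).symm (φ ∘ₗ schurRetract n B)
    have hx : x ∈ (schurSub n (dualFunctor B)).toSubmodule := by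
      rw [mem_schurSub_iff_zeroOut]
      intro i
      refine (dualStdEquiv n B).injective (LinearMap.ext fun y => ?_)
      rw [dualStdEquiv_map B (zeroOut_symm {i}), LinearEquiv.apply_symm_apply, map_zero,
        LinearMap.comp_apply, LinearMap.zero_apply]
      have : schurRetract n B ((B.map (zeroOut k {i})).hom y) = 0 :=
        schurIncl_injective (by
          rw [schurIncl_schurRetract, schurProj_map_zeroOut, map_zero])
      rw [this, map_zero]
    refine ⟨schurRetract n _ x, LinearMap.ext fun y => ?_⟩
    rw [dualSchurLin_apply, schurIncl_schurRetract, schurProj_of_mem _ hx,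
      LinearEquiv.apply_symm_apply, LinearMap.comp_apply, schurRetract_schurIncl]

theorem dualSchurLin_smul (σ : Equiv.Perm (Fin n)) (x : SchurModule n (dualFunctor B))
    (y : SchurModule n B) : dualSchurLin B (MonoidAlgebra.single σ (1 : k) • x) y
      = dualSchurLin B x (MonoidAlgebra.single σ⁻¹ (1 : k) • y) := by
  rw [dualSchurLin_apply, dualSchurLin_apply, schurIncl_smul, schurIncl_smul,
    dualStdEquiv_map B (permMap_transpose σ)]

end DualSchur

/-! ### Self-duality of free functors of finite rank -/

section FreeDual

variable {k : Type u} [Field k] {n : ℕ} {J : Type u}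

/-- The pairing of `V^{⊗ n}` with the `n`-th tensor power of the dual of `V`, summed over the
copies of `T_n`. -/
def freePairing [Finite J] (V : ModuleCat.{u} k) :
    (freeTensorPow k n J).obj V →ₗ[k] DualAt (freeTensorPow k n J) V :=
  have := Fintype.ofFinite J
  LinearMap.flip (∑ j : J, (freeCoord k n V j).dualMap ∘ₗ
    (PiTensorProduct.dualDistrib (R := k) (M := fun _ : Fin n => (V : Type u))) ∘ₗ
      freeCoord k n (ModuleCat.of k (Module.Dual k V)) j)

theorem freePairing_freeTensor [Finite J] (V : ModuleCat.{u} k)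
    (z : (freeTensorPow k n J).obj V) (j : J) (t : ⨂[k] _ : Fin n, Module.Dual k V) :
    freePairing V z (freeLin k n (ModuleCat.of k (Module.Dual k V)) j t)
      = PiTensorProduct.dualDistrib t (freeCoord k n V j z) := by
  classical
  have := Fintype.ofFinite J
  rw [freePairing, LinearMap.flip_apply, LinearMap.sum_apply, LinearMap.sum_apply,
    Finset.sum_eq_single j]
  · rw [LinearMap.comp_apply, LinearMap.comp_apply, LinearMap.dualMap_apply, freeCoord_freeLin,
      if_pos rfl]
  · intro i _ hi
    rw [LinearMap.comp_apply, LinearMap.comp_apply, freeCoord_freeLin, if_neg hi.symm, map_zero,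
      map_zero, LinearMap.zero_apply]
  · simp

theorem dualDistrib_map {V W : ModuleCat.{u} k} (f : V ⟶ W)
    (t : ⨂[k] _ : Fin n, Module.Dual k W) (x : ⨂[k] _ : Fin n, V) :
    PiTensorProduct.dualDistrib t (PiTensorProduct.map (fun _ => f.hom) x)
      = PiTensorProduct.dualDistrib (PiTensorProduct.map (fun _ => f.hom.dualMap) t) x := by
  induction t using PiTensorProduct.induction_on with
  | smul_tprod r φ =>
    induction x using PiTensorProduct.induction_on with
    | smul_tprod r' v =>
      simp only [map_smul, LinearMap.smul_apply, PiTensorProduct.map_tprod,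
        PiTensorProduct.dualDistrib_apply, LinearMap.dualMap_apply]
    | add x y hx hy => rw [map_add, map_add, map_add, hx, hy]
  | add t t' ht ht' => rw [map_add, map_add, map_add, LinearMap.add_apply, LinearMap.add_apply,
      ht, ht']

theorem freePairing_map [Finite J] {V W : ModuleCat.{u} k} (f : V ⟶ W)
    (z : (freeTensorPow k n J).obj V) :
    freePairing W (((freeTensorPow k n J).map f).hom z)
      = dualAtMap (freeTensorPow k n J) f.hom (freePairing V z) := by
  refine freeTensorPow_lin_ext fun j φ => ?_
  rw [freeTensor, freePairing_freeTensor, freeCoord_map, dualDistrib_map]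
  refine (freePairing_freeTensor V z j _).symm.trans (congrArg (freePairing V z) ?_)
  exact (freeTensorPow_map_freeLin (ModuleCat.ofHom f.hom.dualMap) j _).symm

theorem freePairing_bijective [Finite J] (V : ModuleCat.{u} k) [Module.Finite k V] :
    Function.Bijective (freePairing (n := n) (J := J) V) := by
  have hi : Function.Injective (freePairing (n := n) (J := J) V) := by
    rw [← LinearMap.ker_eq_bot, LinearMap.ker_eq_bot']
    intro z hz
    refine free_ext fun j => ?_
    rw [map_zero, ← Module.forall_dual_apply_eq_zero_iff k]
    intro φ
    obtain ⟨t, rfl⟩ := (PiTensorProduct.dualDistribEquiv (R := k)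
      (M := fun _ : Fin n => (V : Type u))).surjective φ
    refine (freePairing_freeTensor V z j t).symm.trans ?_
    rw [hz, LinearMap.zero_apply]
  -- A noncanonical isomorphism, used only to compare dimensions.
  have e : V ≅ ModuleCat.of k (Module.Dual k V) :=
    (LinearEquiv.ofFinrankEq V (Module.Dual k V) Subspace.dual_finrank_eq.symm).toModuleIso
  have : Module.Finite k ((freeTensorPow k n J).obj (ModuleCat.of k (Module.Dual k V))) :=
    have : Module.Finite k (ModuleCat.of k (Module.Dual k V)) :=
      inferInstanceAs (Module.Finite k (Module.Dual k V))
    inferInstance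
  refine ⟨hi, (LinearMap.injective_iff_surjective_of_finrank_eq_finrank ?_).1 hi⟩
  rw [Subspace.dual_finrank_eq]
  exact ((freeTensorPow k n J).mapIso e).toLinearEquiv.finrank_eq

/-- On finite-dimensional modules, the free functors of finite rank are self-dual. -/
def freeDualAtEquiv [Finite J] (V : ModuleCat.{u} k) [Module.Finite k V] :
    DualAt (freeTensorPow k n J) V ≃ₗ[k] (freeTensorPow k n J).obj V :=
  (LinearEquiv.ofBijective _ (freePairing_bijective V)).symm

theorem freeDualAtEquiv_map [Finite J] {V W : ModuleCat.{u} k} [Module.Finite k V]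
    [Module.Finite k W] (f : V ⟶ W) (x : DualAt (freeTensorPow k n J) V) :
    freeDualAtEquiv W (dualAtMap (freeTensorPow k n J) f.hom x)
      = ((freeTensorPow k n J).map f).hom (freeDualAtEquiv V x) := by
  obtain ⟨z, rfl⟩ := (freeDualAtEquiv V).symm.surjective x
  refine (freeDualAtEquiv W).symm.injective ?_
  rw [LinearEquiv.symm_apply_apply, LinearEquiv.apply_symm_apply]
  exact (freePairing_map f z).symm

/-- The value of a functor at the inclusion of a submodule is injective. -/
theorem map_subtype_injective (B : ModuleCat.{u} k ⥤ ModuleCat.{u} k) {V : ModuleCat.{u} k}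
    (S : Submodule k V) :
    Function.Injective (B.map (ModuleCat.ofHom S.subtype : ModuleCat.of k S ⟶ V)).hom := by
  obtain ⟨g, hg⟩ := LinearMap.exists_leftInverse_of_injective S.subtype
    (LinearMap.ker_eq_bot.2 S.injective_subtype)
  refine Function.LeftInverse.injective (g := (B.map (ModuleCat.ofHom g)).hom) fun x => ?_
  rw [map_map_apply, ← ModuleCat.ofHom_comp, hg, ModuleCat.ofHom_id, B.map_id]
  rfl

/-- The restriction of the self-duality of a free functor to a term of the direct system. -/
def freeDualTerm [Finite J] (V : ModuleCat.{u} k) (S : FinSub V) :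
    DualAt (freeTensorPow k n J) S.1 →ₗ[k] (freeTensorPow k n J).obj V :=
  have : Module.Finite k (ModuleCat.of k S.1) := S.2
  ((freeTensorPow k n J).map (ModuleCat.ofHom S.1.subtype : ModuleCat.of k S.1 ⟶ V)).hom ∘ₗ
    (freeDualAtEquiv (ModuleCat.of k S.1)).toLinearMap

/-- Serves twice: with f the identity it gives compatibility with the direct system, with g the
restriction of f it gives naturality. -/
theorem freeDualTerm_dualAtMap [Finite J] {V W : ModuleCat.{u} k} (f : V ⟶ W) (S : FinSub V)
    (T : FinSub W) (g : S.1 →ₗ[k] T.1) (hg : T.1.subtype ∘ₗ g = f.hom ∘ₗ S.1.subtype)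
    (x : DualAt (freeTensorPow k n J) S.1) :
    freeDualTerm W T (dualAtMap _ g x)
      = ((freeTensorPow k n J).map f).hom (freeDualTerm V S x) := by
  have : Module.Finite k (ModuleCat.of k S.1) := S.2
  have : Module.Finite k (ModuleCat.of k T.1) := T.2
  change ((freeTensorPow k n J).map _).hom (freeDualAtEquiv (ModuleCat.of k T.1) (dualAtMap _ g x))
    = ((freeTensorPow k n J).map f).hom (((freeTensorPow k n J).map _).hom _)
  rw [map_map_apply]
  refine (congrArg _ (freeDualAtEquiv_map
    (ModuleCat.ofHom g : ModuleCat.of k S.1 ⟶ ModuleCat.of k T.1) x)).trans ?_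
  rw [map_map_apply, ← ModuleCat.ofHom_comp, hg]
  rfl

/-- The self-duality of a free functor of finite rank. -/
def freeDualLin [Finite J] (V : ModuleCat.{u} k) :
    DualObj (freeTensorPow k n J) V →ₗ[k] (freeTensorPow k n J).obj V :=
  dualLift (freeDualTerm V) fun S T h x => by
    rw [freeDualTerm_dualAtMap (𝟙 V) S T _ (Submodule.subtype_comp_inclusion _ _ h),
      CategoryTheory.Functor.map_id]
    rfl

theorem freeDualLin_of [Finite J] (V : ModuleCat.{u} k) (S : FinSub V)
    (x : DualAt (freeTensorPow k n J) S.1) :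
    freeDualLin V (dualOf _ V S x) = freeDualTerm V S x :=
  dualLift_of _ _ S x

/-- Inclusions of subspaces split, so every term of the system embeds. Surjectivity holds because a
pure tensor already lives on the finite-dimensional span of its factors. -/
theorem freeDualLin_bijective [Finite J] (V : ModuleCat.{u} k) :
    Function.Bijective (freeDualLin (n := n) (J := J) V) := by
  refine ⟨dualLift_injective _ _ fun S => ?_, ?_⟩
  · have : Module.Finite k (ModuleCat.of k S.1) := S.2
    exact (map_subtype_injective _ S.1).comp (freeDualAtEquiv (ModuleCat.of k S.1)).injective
  · have key : ∀ (j : J) (v : Fin n → V),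
        freeTensor k j v ∈ LinearMap.range (freeDualLin (n := n) (J := J) V) := by
      intro j v
      let S : FinSub V := ⟨Submodule.span k (Set.range v),
        Module.Finite.span_of_finite k (Set.finite_range v)⟩
      have : Module.Finite k (ModuleCat.of k S.1) := S.2
      let v' : Fin n → ModuleCat.of k S.1 :=
        fun i => ⟨v i, Submodule.subset_span (Set.mem_range_self i)⟩
      refine ⟨dualOf _ V S ((freeDualAtEquiv (ModuleCat.of k S.1)).symm (freeTensor k j v')), ?_⟩
      rw [freeDualLin_of]
      refine (congrArg ((freeTensorPow k n J).map _).hom ((freeDualAtEquiv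
        (ModuleCat.of k S.1)).apply_symm_apply (freeTensor k j v'))).trans ?_
      exact freeTensorPow_map_freeTensor (ModuleCat.ofHom S.1.subtype : ModuleCat.of k S.1 ⟶ V) j v'
    rw [← LinearMap.range_eq_top, ← Submodule.ker_mkQ (LinearMap.range (freeDualLin V)),
      LinearMap.ker_eq_top]
    refine freeTensorPow_lin_ext fun j v => ?_
    rw [LinearMap.zero_apply, Submodule.mkQ_apply, Submodule.Quotient.mk_eq_zero]
    exact key j v

/-- A free functor of finite rank is isomorphic to its dual. -/
def freeDualHom [Finite J] : dualFunctor (freeTensorPow k n J) ⟶ freeTensorPow k n J where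
  app V := ModuleCat.ofHom (freeDualLin V)
  naturality V W f := by
    ext : 1
    refine LinearMap.ext fun x => ?_
    obtain ⟨S, x, rfl⟩ := exists_dualOf x
    change freeDualLin W (dualObjMap _ f (dualOf _ V S x))
      = ((freeTensorPow k n J).map f).hom (freeDualLin V (dualOf _ V S x))
    rw [dualObjMap_of, freeDualLin_of, freeDualLin_of]
    exact freeDualTerm_dualAtMap f S (S.map f) (S.restr f) rfl x

instance isIso_freeDualHom [Finite J] : IsIso (freeDualHom (k := k) (n := n) (J := J)) := by
  have (V : ModuleCat.{u} k) : IsIso ((freeDualHom (k := k) (n := n) (J := J)).app V) :=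
    (ConcreteCategory.isIso_iff_bijective _).2 (freeDualLin_bijective V)
  exact NatIso.isIso_of_isIso_app _

end FreeDual

/-! ### Self-duality of retracts of finite rank -/

section SelfDual

variable {k : Type u} [Field k] {n : ℕ} {B C : ModuleCat.{u} k ⥤ ModuleCat.{u} k} {J : Type u}

/-- Retracts of free functors with isomorphic Schur modules are isomorphic. -/
theorem nonempty_iso_of_schurModule_equiv {J' : Type u} {s : B ⟶ freeTensorPow k n J}
    {r : freeTensorPow k n J ⟶ B} (h : s ≫ r = 𝟙 B) {s' : C ⟶ freeTensorPow k n J'}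
    {r' : freeTensorPow k n J' ⟶ C} (h' : s' ≫ r' = 𝟙 C)
    (e : SchurModule n B ≃ₗ[MonoidAlgebra k (Equiv.Perm (Fin n))] SchurModule n C) :
    Nonempty (B ≅ C) := by
  obtain ⟨f, hf⟩ := (isMultilinear_of_retract h').exists_of_schurMap
    (e.toLinearMap ∘ₗ schurMap r)
  obtain ⟨g, hg⟩ := (isMultilinear_of_retract h).exists_of_schurMap
    (e.symm.toLinearMap ∘ₗ schurMap r')
  have hsf : schurMap (n := n) (s ≫ f) = e.toLinearMap := by
    rw [schurMap_comp, hf, LinearMap.comp_assoc, schurMap_retract_comp h, LinearMap.comp_id]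
  have hsg : schurMap (n := n) (s' ≫ g) = e.symm.toLinearMap := by
    rw [schurMap_comp, hg, LinearMap.comp_assoc, schurMap_retract_comp h', LinearMap.comp_id]
  refine ⟨⟨s ≫ f, s' ≫ g, (isSeparated_of_retract h).hom_ext ?_,
    (isSeparated_of_retract h').hom_ext ?_⟩⟩
  · rw [schurMap_comp, hsf, hsg, schurMap_id, LinearEquiv.symm_comp]
  · rw [schurMap_comp, hsf, hsg, schurMap_id, LinearEquiv.comp_symm]

/-- A retract of a free functor of finite rank is isomorphic to its dual. -/
theorem nonempty_iso_dualFunctor [Finite J] {s : B ⟶ freeTensorPow k n J}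
    {r : freeTensorPow k n J ⟶ B} (h : s ≫ r = 𝟙 B) : Nonempty (B ≅ dualFunctor B) := by
  -- Dualising exchanges s and r; since F^* ≅ F, the dual B^* is again a retract of F.
  have h' : (dualNatTrans r ≫ freeDualHom) ≫ inv freeDualHom ≫ dualNatTrans s
      = 𝟙 (dualFunctor B) := by
    rw [Category.assoc, IsIso.hom_inv_id_assoc, dualNatTrans_retract h]
  have := mono_of_retract h
  have := mono_of_retract h'
  have := finite_schurModule_of_mono (n := n) s
  have := finite_schurModule_of_mono (n := n) (dualNatTrans r ≫ freeDualHom)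
  have := projective_of_retract h
  have := projective_of_retract h'
  -- Both Schur modules are projective and in duality, hence isomorphic; the isomorphism then lifts
  -- to the functors.
  obtain ⟨e⟩ := nonempty_equiv_of_perfect_pairing isConj_inv_perm
    (LinearEquiv.ofBijective (dualSchurLin (n := n) B) (dualSchurLin_bijective B))
    (dualSchurLin_smul B)
  exact nonempty_iso_of_schurModule_equiv h h' e.symm

end SelfDual

end

end TensorFunctor

/-! ### The proposition -/

theorem proposition2p10 {k : Type u} [Field k] (n : ℕ)
    (B : ModuleCat.{u} k ⥤ ModuleCat.{u} k) :
    (TensorFunctor.IsTnProjective n B →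
      Module.Projective (MonoidAlgebra k (Equiv.Perm (Fin n))) (TensorFunctor.SchurModule n B) ∧
      Nonempty (TensorFunctor.schurTensor n B ≅ B)) ∧
    (TensorFunctor.IsSubfunctor n B →
      Module.Projective (MonoidAlgebra k (Equiv.Perm (Fin n))) (TensorFunctor.SchurModule n B) →
      TensorFunctor.IsTnProjective n B ∧ Nonempty (B ≅ TensorFunctor.dualFunctor B)) ∧
    (TensorFunctor.IsQuotientFunctor n B →
      Module.Projective (MonoidAlgebra k (Equiv.Perm (Fin n))) (TensorFunctor.SchurModule n B) →
      TensorFunctor.IsTnProjective n B ∧ Nonempty (B ≅ TensorFunctor.dualFunctor B)) ∧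
    (∀ hB : TensorFunctor.IsSubquotient n B, TensorFunctor.IsTnProjective n B →
      Projective (⟨B, hB⟩ : (TensorFunctor.IsSubquotient (k := k) n).FullSubcategory) ∧
      Injective (⟨B, hB⟩ : (TensorFunctor.IsSubquotient (k := k) n).FullSubcategory)) := by
  refine ⟨fun h => ?_, fun ⟨J, _, i, _⟩ _ => ?_, fun ⟨J, _, p, _⟩ _ => ?_, fun hB h => ?_⟩
  · obtain ⟨J, s, r, hsr⟩ := h.exists_retract
    exact ⟨TensorFunctor.projective_of_retract hsr, TensorFunctor.nonempty_schurTensor_iso hsr⟩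
  · obtain ⟨r, hr⟩ := TensorFunctor.exists_retraction_of_mono i
    exact ⟨TensorFunctor.isTnProjective_of_retract hr, TensorFunctor.nonempty_iso_dualFunctor hr⟩
  · obtain ⟨s, hs⟩ := TensorFunctor.exists_section_of_epi p
    exact ⟨TensorFunctor.isTnProjective_of_retract hs, TensorFunctor.nonempty_iso_dualFunctor hs⟩
  · exact ⟨TensorFunctor.projective_of_isTnProjective hB h,
      TensorFunctor.injective_of_isTnProjective hB h⟩
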